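/- Let $k$ be an algebraically closed field of characteristic $2$. For a finite group $G$, a block of $kG$ is a primitive idempotent $b$ of the centre of $kG$; a defect group of $b$ is a subgroup $D\le G$ minimal subject to $b\in \mathrm{Tr}_D^G((kG)^D)$, where $G$ acts on $kG$ by conjugation and $\mathrm{Tr}_D^G$ is the relative trace, $\mathrm{Tr}_D^G(a)=\sum_{g\in G/D} gag^{-1}$; and $b$ has defect $d$ if its defect groups have order $2^d$. Let $z(kG)$ be the number of isomorphism classes of projective simple $kG$-modules. **Proposition 4.1.** For each group $G$ in the following table, the number of blocks of $kG$ of defect zero and the number $z(kG)$ are both equal to the stated number. | $G$ | number | |---|---| | $S_3$ | $1$ | | $S_3\times S_3$ | $1$ | | $S_3\times S_3\times S_3$ | $1$ | | $S_3\wr C_2$ | $0$ | | $(C_3\times C_3)\rtimes C_2$ | $4$ | | $(C_3)^3\rtimes(C_2\times S_3)$ | $1$ | | $\mathrm{GL}_3(2)$ | $1$ | | $\mathrm{GL}_4(2)$ | $1$ | | $S_6$ | $1$ | | $S_3\wr S_3$ | $1$ | | $S_5$ | $0$ | | $A_7$ | $0$ | | $S_7$ | $0$ | Here $C_n$, $S_n$,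 $A_n$ are the cyclic, symmetric and alternating groups and $\mathrm{GL}_n(2)$ is the general linear group over the field with two elements. In $(C_3\times C_3)\rtimes C_2$ the generator of $C_2$ acts by inversion. In $(C_3)^3\rtimes(C_2\times S_3)$ the generator of $C_2$ acts by inversion and $S_3$ permutes the three coordinates. $H\wr S_n=H^n\rtimes S_n$ is the wreath product in which $S_n$ permutes the $n$ coordinates, with $C_2=S_2$. -/

import Mathlib

open scoped MonoidAlgebra MatrixGroups

/-! ### Blocks, defect groups and projective simple modules -/

namespace DefectZero

universe u v

section Blocks

variable (k : Type u) [Field k] {G : Type v} [Group G]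

/-- The conjugation action of `g` on the group algebra: `a ↦ g a g⁻¹`. -/
noncomputable def conj (g : G) (a : k[G]) : k[G] :=
  MonoidAlgebra.of k G g * a * MonoidAlgebra.of k G g⁻¹

/-- The fixed points `(kG)^D` of a subgroup `D` acting on `kG` by conjugation. -/
def conjFixed (D : Subgroup G) : Set k[G] :=
  {a | ∀ d ∈ D, conj k d a = a}

/-- The relative trace `Tr_D^G(a) = ∑ g a g⁻¹`, where `g` runs over representatives of the left
cosets of `D` in the finite group `G`. It is used only for `a ∈ (kG)^D`, where it does not depend
on the representatives. -/
noncomputable def relTrace (D : Subgroup G) (a : k[G]) : k[G] :=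
  ∑ᶠ x : G ⧸ D, conj k x.out a

variable {k}

/-- `b` is a block (idempotent) of `kG`: a primitive idempotent of the centre of `kG`. -/
structure IsBlock (b : k[G]) : Prop where
  mem_center : b ∈ Subalgebra.center k k[G]
  idem : b * b = b
  ne_zero : b ≠ 0
  primitive : ∀ e ∈ Subalgebra.center k k[G], e * e = e → b * e = e → e = 0 ∨ e = b

/-- `D` is a defect group of the block `b`: a subgroup that is minimal subject to
`b ∈ Tr_D^G((kG)^D)`. -/
def IsDefectGroup (b : k[G]) (D : Subgroup G) : Prop :=
  Minimal (fun E : Subgroup G => b ∈ relTrace k E '' conjFixed k E) D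

/-- The block `b` has defect `d` (in characteristic `p`): its defect groups have order `p ^ d`. -/
def HasDefect (p : ℕ) (b : k[G]) (d : ℕ) : Prop :=
  ∃ D : Subgroup G, IsDefectGroup b D ∧ Nat.card D = p ^ d

variable (k G)

/-- The number (in `ℕ∞`) of `p`-blocks of defect zero of `kG`. -/
noncomputable def numBlocksDefectZero (p : ℕ) : ℕ∞ :=
  {b : k[G] | IsBlock b ∧ HasDefect p b 0}.encard

end Blocks

/-- `z(A)`: the number (in `ℕ∞`) of isomorphism classes of projective simple `A`-modules. A simple
module is cyclic, so modules in the universe of `A` represent all isomorphism classes. -/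
noncomputable def z (A : Type u) [Ring A] : ℕ∞ :=
  {X : Quotient (CategoryTheory.isIsomorphicSetoid (ModuleCat.{u} A)) |
    ∃ M : ModuleCat.{u} A, IsSimpleModule A M ∧ Module.Projective A M ∧
      Quotient.mk (CategoryTheory.isIsomorphicSetoid (ModuleCat.{u} A)) M = X}.encard

/-- In characteristic two, `G` has exactly `n` blocks of defect zero over `k`, and `kG` has exactly
`n` projective simple modules up to isomorphism. -/
def DefectZeroCount (k : Type u) [Field k] (G : Type) [Group G] (n : ℕ) : Prop :=
  numBlocksDefectZero k G 2 = n ∧ z k[G] = n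

/-! ### The groups -/

/-- The symmetric group on `n` points. -/
abbrev Sym (n : ℕ) : Type := Equiv.Perm (Fin n)

/-- The cyclic group of order three, written multiplicatively. -/
abbrev C3 : Type := Multiplicative (ZMod 3)

/-- The permutational wreath product `H ≀ S_n = H^n ⋊ S_n`, where `S_n` permutes the `n`
coordinates: `(σ • f) i = f (σ⁻¹ i)`. -/
abbrev Wr (H : Type) [Group H] (n : ℕ) : Type :=
  (Fin n → H) ⋊[mulAutArrow] Sym n

/-- The action of the group `ℤˣ = {1, -1}` of order two on an abelian group in which `-1` acts by
inversion. -/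
def inversionAction (A : Type) [CommGroup A] : ℤˣ →* MulAut A where
  toFun u :=
    { toFun := fun a => a ^ (u : ℤ)
      invFun := fun a => a ^ (u : ℤ)
      left_inv := fun a => by
        show (a ^ (u : ℤ)) ^ (u : ℤ) = a
        rw [← zpow_mul, Int.units_coe_mul_self, zpow_one]
      right_inv := fun a => by
        show (a ^ (u : ℤ)) ^ (u : ℤ) = a
        rw [← zpow_mul, Int.units_coe_mul_self, zpow_one]
      map_mul' := fun a b => mul_zpow a b _ }
  map_one' := by
    ext a
    show a ^ ((1 : ℤˣ) : ℤ) = a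
    simp
  map_mul' u v := by
    ext a
    show a ^ ((u * v : ℤˣ) : ℤ) = (a ^ (v : ℤ)) ^ (u : ℤ)
    rw [← zpow_mul, mul_comm u v, Units.val_mul]

/-- The group `(C₃ × C₃) ⋊ C₂`, with `C₂ = {1, -1}` acting by inversion. -/
abbrev C3SqInv : Type := (C3 × C3) ⋊[inversionAction (C3 × C3)] ℤˣ

/-- The action of `C₂ × S₃` on `(C₃)³`: the factor `C₂ = {1, -1}` acts by inversion and `S₃`
permutes the coordinates. -/
def inversionPermAction : ℤˣ × Sym 3 →* MulAut (Fin 3 → C3) :=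
  (inversionAction (Fin 3 → C3)).noncommCoprod mulAutArrow fun u σ => by
    ext f i
    rfl

/-- The group `(C₃)³ ⋊ (C₂ × S₃)`. -/
abbrev C3CubeInvPerm : Type := (Fin 3 → C3) ⋊[inversionPermAction] (ℤˣ × Sym 3)

end DefectZero

namespace DefectZero

open MonoidAlgebra

universe u v

/-! ### The centre of the group algebra. -/

section Algebra

variable {k : Type u} [Field k] {G : Type v} [Group G]

/-! Everything takes place in the projective centre `projCenter`, the image of the trace from the
trivial subgroup, which is an ideal of the centre of kG. A block has defect zero exactly when it
lies there (`hasDefect_zero_iff`). Higman's averaging argument, with Schur's lemma and Jacobson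
density, matches these blocks with the projective simple modules (`z_eq`). Both numbers in the
statement therefore count the blocks in the projective centre.

In characteristic 2 this ideal consists of the class functions supported on elements whose
centralizer has odd order (`coeff_eq_zero_of_centralized`, `mem_projCenter_of_coeff`). For S₃ ≀ C₂
there are no such elements. In most of the other groups they form a single class, with class sum c
and c² = ac, where a is a structure constant modulo 2: if a is odd, c is the only block of defect
zero, and if a is even there is none. The parity of a is found from a pairing of factorizations
whose fixed points are few (`card_modEq_card_intertwining`). The class property and an odd a pass to
direct products (`IsOddClass.prod`). For (C₃ × C₃) ⋊ C₂ four orthogonal idempotents span the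
projective centre.

In A₇ a block need not be invariant under S₇, but it lies below an S₇-invariant idempotent e of the
projective centre. Cross terms cancel in e², and the squares of the relevant class sums have even
coefficients wherever e may be nonzero, so e = 0.

For GLₙ(2) let P be the unitriangular subgroup, P̂ the sum of its elements and w the antidiagonal
permutation matrix. If z lies in the projective centre, zP̂ is constant on (P, P)-double cosets and
vanishes off the big Bruhat cell PwP, so it is determined by one coefficient. Since bP̂ ≠ 0 for
every block b of defect zero, there is at most one such block. One exists because the sum of the
elements satisfying gⁿ = g + 1, for n = 3 or 4, is not nilpotent. -/

theorem mem_center_of_forall_of {z : k[G]} (hz : ∀ g, of k G g * z = z * of k G g) :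
    z ∈ Subalgebra.center k k[G] := by
  rw [Subalgebra.mem_center_iff]
  intro b
  induction b using MonoidAlgebra.induction_on with
  | of m => exact hz m
  | add x y hx hy => rw [add_mul, mul_add, hx, hy]
  | smul r x hx => rw [smul_mul_assoc, hx, mul_smul_comm]

theorem conjFixed_bot : conjFixed k (⊥ : Subgroup G) = Set.univ := by
  ext a
  simp [conjFixed, conj, ← one_def]

end Algebra

/-! ### The trace, the projective centre and defect zero. -/

section Trace

variable (k : Type u) [Field k] (G : Type v) [Group G] [Fintype G]

/-- The relative trace from the trivial subgroup, `a ↦ ∑ g a g⁻¹`. -/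
noncomputable def trace : k[G] →ₗ[k] k[G] :=
  ∑ g : G, LinearMap.mulLeft k (of k G g) ∘ₗ LinearMap.mulRight k (of k G g⁻¹)

variable {k G}

theorem trace_apply (a : k[G]) : trace k G a = ∑ g : G, of k G g * a * of k G g⁻¹ := by
  simp [trace, mul_assoc]

theorem of_mul_trace (h : G) (a : k[G]) : of k G h * trace k G a = trace k G a * of k G h := by
  rw [trace_apply, Finset.mul_sum, Finset.sum_mul]
  refine Fintype.sum_equiv (Equiv.mulLeft h) _ _ fun g => ?_
  simp only [Equiv.coe_mulLeft, mul_inv_rev, map_mul, mul_assoc]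
  rw [← map_mul (of k G) h⁻¹ h, inv_mul_cancel, map_one, mul_one]

theorem trace_mem_center (a : k[G]) : trace k G a ∈ Subalgebra.center k k[G] :=
  mem_center_of_forall_of fun g => of_mul_trace g a

theorem trace_mul {z : k[G]} (hz : z ∈ Subalgebra.center k k[G]) (a : k[G]) :
    trace k G (z * a) = z * trace k G a := by
  rw [Subalgebra.mem_center_iff] at hz
  simp only [trace_apply, Finset.mul_sum, ← mul_assoc, hz]

variable (k G) in
/-- The projective centre of `kG`: the image of the trace from the trivial subgroup. -/
noncomputable def projCenter : Submodule k k[G] := LinearMap.range (trace k G)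

theorem mem_projCenter {z : k[G]} : z ∈ projCenter k G ↔ ∃ a, trace k G a = z := Iff.rfl

theorem projCenter_le_center {z : k[G]} (hz : z ∈ projCenter k G) :
    z ∈ Subalgebra.center k k[G] := by
  obtain ⟨a, rfl⟩ := hz
  exact trace_mem_center a

theorem mul_mem_projCenter {z y : k[G]} (hz : z ∈ projCenter k G)
    (hy : y ∈ Subalgebra.center k k[G]) : y * z ∈ projCenter k G := by
  obtain ⟨a, rfl⟩ := hz
  exact ⟨y * a, trace_mul hy a⟩

theorem relTrace_bot (a : k[G]) : relTrace k (⊥ : Subgroup G) a = trace k G a := by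
  have := Fintype.ofFinite (G ⧸ (⊥ : Subgroup G))
  rw [relTrace, trace_apply, finsum_eq_sum_of_fintype]
  refine Fintype.sum_bijective (fun x : G ⧸ (⊥ : Subgroup G) => x.out) ⟨?_, ?_⟩ _ _ fun x => rfl
  · intro x y h
    rw [← Quotient.out_eq x, ← Quotient.out_eq y]
    exact congrArg _ h
  · intro g
    refine ⟨(g : G ⧸ (⊥ : Subgroup G)), ?_⟩
    have : ((QuotientGroup.mk g : G ⧸ (⊥ : Subgroup G)).out : G ⧸ (⊥ : Subgroup G)) = g :=
      Quotient.out_eq _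
    rw [QuotientGroup.eq] at this
    simpa [inv_mul_eq_one] using this

/-- A subgroup of order p⁰ is trivial, and the trivial subgroup is minimal as soon as it satisfies
the trace condition. -/
theorem hasDefect_zero_iff {p : ℕ} {b : k[G]} : HasDefect p b 0 ↔ b ∈ projCenter k G := by
  have key : b ∈ relTrace k (⊥ : Subgroup G) '' conjFixed k ⊥ ↔ b ∈ projCenter k G := by
    simp [conjFixed_bot, relTrace_bot, mem_projCenter]
  constructor
  · rintro ⟨D, hD, hc⟩
    rw [pow_zero, Subgroup.card_eq_one] at hc
    subst hc
    exact key.1 hD.prop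
  · intro h
    refine ⟨⊥, ⟨key.2 h, fun E _ _ => bot_le⟩, by simp⟩

theorem numBlocksDefectZero_eq (p : ℕ) :
    numBlocksDefectZero k G p = {b : k[G] | IsBlock b ∧ b ∈ projCenter k G}.encard := by
  simp [numBlocksDefectZero, hasDefect_zero_iff]

end Trace

/-! ### Central idempotents and blocks. -/

section Blocks

variable {k : Type u} [Field k] {G : Type v} [Group G]

/-- The product is a central idempotent below both blocks; by primitivity it would equal each of
them if it were nonzero. -/
theorem IsBlock.mul_eq_zero {b c : k[G]} (hb : IsBlock b) (hc : IsBlock c) (h : b ≠ c) :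
    b * c = 0 := by
  have cb := Subalgebra.mem_center_iff.1 hb.mem_center
  have hmem : b * c ∈ Subalgebra.center k k[G] := mul_mem hb.mem_center hc.mem_center
  have hid : b * c * (b * c) = b * c := by
    rw [← mul_assoc, mul_assoc b c b, cb c, ← mul_assoc, hb.idem, mul_assoc, hc.idem]
  rcases hb.primitive _ hmem hid (by rw [← mul_assoc, hb.idem]) with h0 | h1
  · exact h0
  rcases hc.primitive _ hmem hid (by rw [← mul_assoc, cb c, mul_assoc, hc.idem]) with h0 | h2
  · exact h0
  exact absurd (h1.symm.trans h2) h

variable [Finite G]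

/-- Below every central idempotent in a family closed under one side of each splitting
there is a block in the family. -/
theorem exists_isBlock_of_family (P : k[G] → Prop) (h0 : ¬ P 0)
    (hsplit : ∀ e f : k[G], e ∈ Subalgebra.center k k[G] → e * e = e → P e →
      f ∈ Subalgebra.center k k[G] → f * f = f → e * f = f → P f ∨ P (e - f))
    {e : k[G]} (he : e ∈ Subalgebra.center k k[G]) (hee : e * e = e) (hP : P e) :
    ∃ b, IsBlock b ∧ P b ∧ e * b = b := by
  classical
  induction hn : Module.finrank k (LinearMap.range (LinearMap.mulLeft k e))
    using Nat.strong_induction_on generalizing e with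
  | _ n ih =>
    -- The induction is on the dimension of e·kG, which drops for every proper central idempotent
    -- below e.
    have hlt : ∀ f ∈ Subalgebra.center k k[G], f * f = f → e * f = f → f ≠ e →
        Module.finrank k (LinearMap.range (LinearMap.mulLeft k f)) < n := by
      intro f hf hff hef hne
      rw [← hn]
      have hle : LinearMap.range (LinearMap.mulLeft k f) ≤
          LinearMap.range (LinearMap.mulLeft k e) := by
        rintro _ ⟨x, rfl⟩
        exact ⟨f * x, by simp [← mul_assoc, hef]⟩
      refine Submodule.finrank_lt_finrank_of_lt (lt_of_le_of_ne hle fun heq => hne ?_)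
      have : e ∈ LinearMap.range (LinearMap.mulLeft k f) := by
        rw [heq]; exact ⟨e, hee⟩
      obtain ⟨x, hx⟩ := this
      have hfe : f * e = e := by rw [← hx]; simp [← mul_assoc, hff]
      rw [← hef, Subalgebra.mem_center_iff.1 hf e, hfe]
    by_cases hprim : ∀ f ∈ Subalgebra.center k k[G], f * f = f → e * f = f → f = 0 ∨ f = e
    · exact ⟨e, ⟨he, hee, fun h => h0 (h ▸ hP), hprim⟩, hP, hee⟩
    · push Not at hprim
      obtain ⟨f, hf, hff, hef, hf0, hfe⟩ := hprim
      have hfe' : f * e = f := by rw [← Subalgebra.mem_center_iff.1 hf e, hef]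
      rcases hsplit e f he hee hP hf hff hef with h | h
      · obtain ⟨b, hb, hPb, hbf⟩ := ih _ (hlt f hf hff hef hfe) hf hff h rfl
        exact ⟨b, hb, hPb, by rw [← hbf, ← mul_assoc, hef]⟩
      · have hid : (e - f) * (e - f) = e - f := by
          simp [mul_sub, sub_mul, hee, hff, hef, hfe']
        have hid' : e * (e - f) = e - f := by simp [mul_sub, hee, hef]
        obtain ⟨b, hb, hPb, hbf⟩ := ih _ (hlt _ (sub_mem he hf) hid hid'
          (by simpa using hf0)) (sub_mem he hf) hid h rfl
        exact ⟨b, hb, hPb, by rw [← hbf, ← mul_assoc, hid']⟩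

/-- The Fitting idempotent of a central element. -/
theorem exists_fitting_idempotent {z : k[G]} (hz : z ∈ Subalgebra.center k k[G]) :
    ∃ n : ℕ, ∃ y ∈ Subalgebra.center k k[G],
      (z ^ (n + 1) * y) * (z ^ (n + 1) * y) = z ^ (n + 1) * y ∧
      z ^ (n + 1) * (z ^ (n + 1) * y) = z ^ (n + 1) := by
  let Z := Subalgebra.center k k[G]
  have : IsArtinianRing Z := IsArtinianRing.of_finite k Z
  let w : Z := ⟨z, hz⟩
  obtain ⟨n, x, hx⟩ := IsArtinian.exists_pow_succ_smul_dvd w (1 : Z)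
  simp only [smul_eq_mul, mul_one, Nat.succ_eq_add_one] at hx
  -- The centre is Artinian, so the powers of w generate a stationary chain of ideals: wⁿ = wⁿ⁺¹x.
  -- Iterating this n + 1 times makes wⁿ⁺¹xⁿ⁺¹ idempotent.
  have hstep : ∀ m : ℕ, w ^ (n + m) * x ^ m = w ^ n := by
    intro m
    induction m with
    | zero => simp
    | succ m ih =>
      calc w ^ (n + (m + 1)) * x ^ (m + 1) = (w ^ (n + 1) * x) * (w ^ m * x ^ m) := by ring
        _ = w ^ (n + m) * x ^ m := by rw [hx]; ring
        _ = w ^ n := ih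
  have hfin : w ^ (n + 1) * (w ^ (n + 1) * x ^ (n + 1)) = w ^ (n + 1) := by
    calc _ = (w ^ (n + (n + 1)) * x ^ (n + 1)) * w := by ring
      _ = _ := by rw [hstep]; ring
  refine ⟨n, ((x ^ (n + 1) : Z) : k[G]), (x ^ (n + 1)).2, ?_, ?_⟩
  · have : (w ^ (n + 1) * x ^ (n + 1)) * (w ^ (n + 1) * x ^ (n + 1)) = w ^ (n + 1) * x ^ (n + 1) := by
      calc _ = (w ^ (n + 1) * (w ^ (n + 1) * x ^ (n + 1))) * x ^ (n + 1) := by ring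
        _ = _ := by rw [hfin]
    exact congrArg Subtype.val this
  · exact congrArg Subtype.val hfin

end Blocks

/-! ### Projective simple modules and Higman's criterion. -/

section Modules

variable {k : Type u} [Field k] {G : Type v} [Group G]
variable {M : Type*} [AddCommGroup M] [Module k[G] M]

/-- As e is central, its fixed vectors form a submodule, which contains eM. -/
theorem central_idempotent_smul [IsSimpleModule k[G] M] {e : k[G]}
    (he : e ∈ Subalgebra.center k k[G]) (hee : e * e = e) :
    (∀ m : M, e • m = m) ∨ (∀ m : M, e • m = 0) := by
  rw [Subalgebra.mem_center_iff] at he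
  let N : Submodule k[G] M :=
    { carrier := {m | e • m = m}
      zero_mem' := smul_zero e
      add_mem' := fun {x y} hx hy => by
        simp only [Set.mem_ofPred_eq] at *
        rw [smul_add, hx, hy]
      smul_mem' := fun c x hx => by
        simp only [Set.mem_ofPred_eq] at *
        rw [smul_smul, ← he, mul_smul, hx] }
  rcases eq_bot_or_eq_top N with h | h
  · right
    intro m
    have : e • m ∈ N := show e • e • m = e • m by rw [smul_smul, hee]
    rwa [h] at this
  · left
    intro m
    have : m ∈ N := h ▸ Submodule.mem_top
    exact this

theorem trace_smul [Fintype G] (a : k[G]) (m : M) :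
    trace k G a • m = ∑ g : G, of k G g • a • of k G g⁻¹ • m := by
  simp [trace_apply, Finset.sum_smul, mul_smul]

variable [Module k M] [IsScalarTower k k[G] M]

theorem finite_of_isSimpleModule [Finite G] [IsSimpleModule k[G] M] : Module.Finite k M :=
  Module.Finite.trans k[G] M

/-- Jacobson density for modules of finite dimension. -/
theorem exists_smul_eq [IsSemisimpleModule k[G] M] [Module.Finite k M] (θ : M →ₗ[k] M)
    (hθ : ∀ (φ : Module.End k[G] M) (m : M), θ (φ m) = φ (θ m)) :
    ∃ r : k[G], ∀ m, θ m = r • m := by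
  obtain ⟨s, hs⟩ := Module.Finite.fg_top (R := k) (M := M)
  let f : Module.End (Module.End k[G] M) M :=
    { toFun := θ, map_add' := map_add θ, map_smul' := fun φ m => hθ φ m }
  obtain ⟨r, hr⟩ := jacobson_density f s
  refine ⟨r, fun m => ?_⟩
  have hm : m ∈ Submodule.span k (s : Set M) := hs ▸ Submodule.mem_top
  induction hm using Submodule.span_induction with
  | mem x hx => exact hr x hx
  | zero => simp
  | add x y _ _ hx hy => rw [map_add, hx, hy, smul_add]
  | smul c x _ hx => rw [map_smul, hx, smul_algebra_smul_comm]

variable [Fintype G]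

/-- A module on which an element of the projective centre acts as the identity is projective. -/
theorem projective_of_smul_eq {z : k[G]} (hz : z ∈ projCenter k G) (h : ∀ m : M, z • m = m) :
    Module.Projective k[G] M := by
  obtain ⟨a, rfl⟩ := hz
  let π : (M →₀ k[G]) →ₗ[k[G]] M := Finsupp.linearCombination k[G] id
  have hπ : Function.Surjective π := Finsupp.linearCombination_id_surjective k[G] M
  obtain ⟨s, hs⟩ := (π.restrictScalars k).exists_rightInverse_of_surjective
    (LinearMap.range_eq_top.2 hπ)
  have hs' : ∀ m, π (s m) = m := fun m => LinearMap.congr_fun hs m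
  -- Averaging a k-linear section s as m ↦ ∑ g a s(g⁻¹m) makes it equivariant, and composing with π
  -- gives the action of Tr(a), which is the identity.
  let t : M →ₗ[k] (M →₀ k[G]) := ∑ g : G,
    (Module.toModuleEnd k (S := k[G]) (M →₀ k[G]) (of k G g * a)) ∘ₗ s ∘ₗ
      (Module.toModuleEnd k (S := k[G]) M (of k G g⁻¹))
  have ht : ∀ m, t m = ∑ g : G, (of k G g * a) • s (of k G g⁻¹ • m) := fun m => by
    simp [t]
  let T := equivariantOfLinearOfComm t fun g m => by
    change t (of k G g • m) = of k G g • t m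
    rw [ht, ht, Finset.smul_sum]
    refine Fintype.sum_equiv (Equiv.mulLeft g⁻¹) _ _ fun h => ?_
    simp only [Equiv.coe_mulLeft, smul_smul, ← mul_assoc, ← map_mul, mul_inv_rev, inv_inv,
      mul_inv_cancel, one_mul]
  refine ⟨T, fun m => ?_⟩
  change π (t m) = m
  rw [ht, map_sum]
  simp only [map_smul, hs']
  have := h m
  rw [trace_smul] at this
  simpa only [mul_smul] using this

/-- On a projective simple module over an algebraically closed field some element of the
projective centre acts as the identity. -/
theorem exists_projCenter_smul_eq [IsAlgClosed k] [IsSimpleModule k[G] M]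
    [Module.Projective k[G] M] : ∃ z ∈ projCenter k G, ∀ m : M, z • m = m := by
  have := finite_of_isSimpleModule (k := k) (G := G) (M := M)
  obtain ⟨s, hs⟩ := Module.Projective.out (R := k[G]) (P := M)
  -- ε reads off the coefficient at 1 in each copy of kG. Averaging ε over G recovers the projection
  -- onto M, so averaging ε ∘ s gives the identity.
  let ε : (M →₀ k[G]) →ₗ[k] M :=
    Finsupp.lsum k fun m => LinearMap.toSpanSingleton k M m ∘ₗ
      (Finsupp.lapply 1 ∘ₗ (coeffLinearEquiv k).toLinearMap)
  have hε : ∀ m (c : k[G]), ε (Finsupp.single m c) = c.coeff 1 • m := fun m c => by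
    simp [ε, coeffLinearEquiv]
  have hrec : ∀ x : M →₀ k[G], ∑ g : G, of k G g • ε (of k G g⁻¹ • x) =
      Finsupp.linearCombination k[G] id x := by
    intro x
    induction x using Finsupp.induction_linear with
    | zero => simp
    | add x y hx hy => simp only [smul_add, map_add, Finset.sum_add_distrib, hx, hy]
    | single m c =>
      simp only [Finsupp.smul_single, hε, Finsupp.linearCombination_single, id]
      have hc : c = ∑ g : G, c.coeff g • of k G g := by
        ext g
        simp [coeff_sum]
      conv_rhs => rw [hc, Finset.sum_smul]
      refine Finset.sum_congr rfl fun g _ => ?_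
      rw [smul_algebra_smul_comm, smul_assoc]
      congr 1
      simp
  -- By Schur's lemma the endomorphisms are scalars, so density realizes any k-linear map by an
  -- element of kG.
  obtain ⟨r, hr⟩ := exists_smul_eq (k := k) (G := G) (M := M) (ε ∘ₗ s.restrictScalars k) (by
    intro φ m
    obtain ⟨c, rfl⟩ := (IsSimpleModule.algebraMap_end_bijective_of_isAlgClosed (A := k[G])
      (V := M) k).2 φ
    simp only [Module.algebraMap_end_apply, map_smul])
  refine ⟨trace k G r, ⟨r, rfl⟩, fun m => ?_⟩
  simp only [trace_smul, ← hr, LinearMap.comp_apply, LinearMap.restrictScalars_apply, map_smul,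
    hrec]
  exact hs m

/-- Two simple modules in a block of the projective centre are isomorphic. -/
theorem nonempty_linearEquiv_of_isBlock {N : Type*} [AddCommGroup N] [Module k[G] N] [Module k N]
    [IsScalarTower k k[G] N] [IsSimpleModule k[G] M] [IsSimpleModule k[G] N] {b : k[G]}
    (hb : IsBlock b) (hbp : b ∈ projCenter k G) (hM : ∀ m : M, b • m = m)
    (hN : ∀ m : N, b • m = m) : Nonempty (M ≃ₗ[k[G]] N) := by
  by_contra hne
  have hMN : ∀ f : M →ₗ[k[G]] N, f = 0 := fun f =>
    (LinearMap.bijective_or_eq_zero f).resolve_left fun h =>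
      hne ⟨LinearEquiv.ofBijective f h⟩
  have hNM : ∀ f : N →ₗ[k[G]] M, f = 0 := fun f =>
    (LinearMap.bijective_or_eq_zero f).resolve_left fun h =>
      hne ⟨(LinearEquiv.ofBijective f h).symm⟩
  obtain ⟨a, ha⟩ := hbp
  have := finite_of_isSimpleModule (k := k) (G := G) (M := M)
  have := finite_of_isSimpleModule (k := k) (G := G) (M := N)
  have : IsSemisimpleModule k[G] (M × N) := by
    have h1 := IsSemisimpleModule.range (LinearMap.inl k[G] M N)
    have h2 := IsSemisimpleModule.range (LinearMap.inr k[G] M N)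
    have h3 := IsSemisimpleModule.sup h1 h2
    rw [LinearMap.sup_range_inl_inr] at h3
    exact h3.congr Submodule.topEquiv.symm
  -- Without nonzero maps between M and N, the map acting as a on M and as 0 on N commutes with all
  -- endomorphisms. By density some r in kG acts like it; then Tr(r) acts as Tr(a) = b, that is as
  -- 1, on M and as 0 on N.
  let θ : (M × N) →ₗ[k] (M × N) :=
    LinearMap.inl k M N ∘ₗ (Module.toModuleEnd k (S := k[G]) M a) ∘ₗ LinearMap.fst k M N
  have hθ : ∀ x : M × N, θ x = (a • x.1, 0) := fun x => by simp [θ]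
  obtain ⟨r, hr⟩ := exists_smul_eq (k := k) (G := G) (M := M × N) θ (by
    rintro φ ⟨m, n⟩
    have h1 : ∀ n : N, (φ (0, n)).1 = 0 := fun n => LinearMap.congr_fun
      (hNM (LinearMap.fst k[G] M N ∘ₗ φ ∘ₗ LinearMap.inr k[G] M N)) n
    have h2 : ∀ m : M, (φ (m, 0)).2 = 0 := fun m => LinearMap.congr_fun
      (hMN (LinearMap.snd k[G] M N ∘ₗ φ ∘ₗ LinearMap.inl k[G] M N)) m
    have h3 : φ (m, n) = φ (m, 0) + φ (0, n) := by rw [← map_add]; simp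
    have h4 : ((a • m, 0) : M × N) = a • (m, 0) := by simp
    rw [hθ, hθ, h4, map_smul]
    ext
    · simp [h3, h1]
    · simp [h2])
  simp only [hθ] at hr
  have hz1 : ∀ m : M, trace k G r • m = m := fun m => by
    have hr' : ∀ m : M, r • m = a • m := fun m => (congrArg Prod.fst (hr (m, 0))).symm
    rw [trace_smul]
    simp only [hr']
    rw [← trace_smul, ha, hM]
  have hz2 : ∀ n : N, trace k G r • n = 0 := fun n => by
    have hr' : ∀ n : N, r • n = 0 := fun n => (congrArg Prod.snd (hr (0, n))).symm
    rw [trace_smul]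
    simp [hr']
  -- The Fitting idempotent of Tr(r) is also 1 on M and 0 on N, so it would split the primitive
  -- idempotent b.
  obtain ⟨n, y, hy, hid, hfit⟩ := exists_fitting_idempotent (trace_mem_center (k := k) r)
  set z := trace k G r
  have hpow : ∀ (j : ℕ) (m : M), z ^ j • m = m := fun j m => by
    induction j with
    | zero => simp
    | succ j ih => rw [pow_succ, mul_smul, hz1, ih]
  set e := z ^ (n + 1) * y with he
  have hec : e ∈ Subalgebra.center k k[G] := mul_mem (pow_mem (trace_mem_center r) _) hy
  have hcomm := Subalgebra.mem_center_iff.1 hec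
  have he1 : ∀ m : M, e • m = m := fun m => by
    rw [← hpow (n + 1) (e • m), ← mul_smul, hfit, hpow]
  have he2 : ∀ x : N, e • x = 0 := fun x => by
    rw [he, ← Subalgebra.mem_center_iff.1 (pow_mem (trace_mem_center r) (n + 1)) y, mul_smul,
      pow_succ, mul_smul, hz2, smul_zero, smul_zero]
  rcases hb.primitive (b * e) (mul_mem hb.mem_center hec)
    (by rw [mul_assoc, ← mul_assoc e b e, ← hcomm b, mul_assoc b e e, hid, ← mul_assoc, hb.idem])
    (by rw [← mul_assoc, hb.idem]) with h | h
  · have := IsSimpleModule.nontrivial k[G] M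
    obtain ⟨m, hm⟩ := exists_ne (0 : M)
    apply hm
    rw [← hM m, ← he1 m, ← mul_smul, h, zero_smul]
  · have := IsSimpleModule.nontrivial k[G] N
    obtain ⟨x, hx⟩ := exists_ne (0 : N)
    apply hx
    rw [← hN x, ← h, mul_smul, he2, smul_zero]

/-- A projective simple module lies in a block belonging to the projective centre. -/
theorem exists_isBlock_smul_eq [IsAlgClosed k] [IsSimpleModule k[G] M]
    [Module.Projective k[G] M] :
    ∃ b : k[G], IsBlock b ∧ b ∈ projCenter k G ∧ ∀ m : M, b • m = m := by
  obtain ⟨z, hz, hz1⟩ := exists_projCenter_smul_eq (k := k) (G := G) (M := M)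
  have hzc := projCenter_le_center hz
  obtain ⟨n, y, hy, hid, hfit⟩ := exists_fitting_idempotent hzc
  have hpow : ∀ (j : ℕ) (m : M), z ^ j • m = m := fun j m => by
    induction j with
    | zero => simp
    | succ j ih => rw [pow_succ, mul_smul, hz1, ih]
  have he1 : ∀ m : M, (z ^ (n + 1) * y) • m = m := fun m => by
    rw [← hpow (n + 1) ((z ^ (n + 1) * y) • m), ← mul_smul, hfit, hpow]
  have := IsSimpleModule.nontrivial k[G] M
  obtain ⟨m₀, hm₀⟩ := exists_ne (0 : M)
  obtain ⟨b, hb, hb1, hbe⟩ := exists_isBlock_of_family (fun e : k[G] => ∀ m : M, e • m = m)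
    (fun h => hm₀ (by rw [← h m₀, zero_smul]))
    (fun e f _ _ hP hf hff _ => by
      rcases central_idempotent_smul (M := M) hf hff with h | h
      · exact Or.inl h
      · exact Or.inr fun m => by rw [sub_smul, hP, h, sub_zero])
    (mul_mem (pow_mem hzc _) hy) hid he1
  refine ⟨b, hb, ?_, hb1⟩
  -- b lies below the Fitting idempotent of z, hence is a central multiple of z.
  rw [← hbe, pow_succ, mul_assoc, mul_assoc, ← Subalgebra.mem_center_iff.1 hzc, ← mul_assoc]
  exact mul_mem_projCenter hz
    (mul_mem (pow_mem hzc _) (mul_mem hy hb.mem_center))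

end Modules

/-! ### Projective simple modules correspond to blocks of defect zero. -/

section Count

variable (k : Type u) [Field k] (G : Type) [Group G] [Fintype G]

/-- The left ideal generated by 1 − b is proper because b ≠ 0; the quotient of kG by a maximal left
ideal containing it is simple, and b acts there as 1. -/
theorem exists_simple_of_isBlock {k : Type u} [Field k] {G : Type} [Group G]
    {b : k[G]} (hb : IsBlock b) :
    ∃ M : ModuleCat.{u} k[G], IsSimpleModule k[G] M ∧ ∀ m : M, b • m = m := by
  have hcomm := Subalgebra.mem_center_iff.1 hb.mem_center
  have hne : Ideal.span {1 - b} ≠ ⊤ := by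
    rw [Ne, Ideal.eq_top_iff_one, Ideal.mem_span_singleton']
    rintro ⟨a, ha⟩
    apply hb.ne_zero
    rw [← mul_one b, ← ha, ← mul_assoc, ← hcomm a, mul_assoc, mul_sub, mul_one, hb.idem, sub_self,
      mul_zero]
  obtain ⟨I, hI, hle⟩ := Ideal.exists_le_maximal _ hne
  have hbI : 1 - b ∈ I := hle (Ideal.mem_span_singleton_self _)
  refine ⟨ModuleCat.of k[G] (k[G] ⧸ I), isSimpleModule_iff_isCoatom.2 hI.out, fun m => ?_⟩
  obtain ⟨x, rfl⟩ := Submodule.Quotient.mk_surjective I m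
  change b • Submodule.Quotient.mk x = Submodule.Quotient.mk (p := I) x
  rw [← Submodule.Quotient.mk_smul, eq_comm, Submodule.Quotient.eq, smul_eq_mul, ← hcomm]
  have := I.mul_mem_left x hbI
  rwa [mul_sub, mul_one] at this

/-- Projective simple modules correspond to the blocks in the projective centre. -/
theorem z_eq [IsAlgClosed k] :
    z k[G] = {b : k[G] | IsBlock b ∧ b ∈ projCenter k G}.encard := by
  choose! M hM hMb using fun (b : k[G]) (hb : IsBlock b) => exists_simple_of_isBlock hb
  let φ : k[G] → Quotient (CategoryTheory.isIsomorphicSetoid (ModuleCat.{u} k[G])) :=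
    fun b => Quotient.mk _ (M b)
  rw [z, ← Set.InjOn.encard_image (f := φ)]
  · congr 1
    ext X
    constructor
    · rintro ⟨N, hN, hNp, rfl⟩
      let _ : Module k N := Module.compHom N (algebraMap k k[G])
      have : IsScalarTower k k[G] N := ⟨fun c x m => by
        rw [Algebra.smul_def, mul_smul]; rfl⟩
      obtain ⟨b, hb, hbp, hbN⟩ := exists_isBlock_smul_eq (k := k) (G := G) (M := N)
      refine ⟨b, ⟨hb, hbp⟩, Quotient.sound ?_⟩
      have := hM b hb
      let _ : Module k (M b) := Module.compHom (M b) (algebraMap k k[G])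
      have : IsScalarTower k k[G] (M b) := ⟨fun c x m => by
        rw [Algebra.smul_def, mul_smul]; rfl⟩
      obtain ⟨e⟩ := nonempty_linearEquiv_of_isBlock hb hbp (hMb b hb) hbN
      exact ⟨e.toModuleIso⟩
    · rintro ⟨b, ⟨hb, hbp⟩, rfl⟩
      let _ : Module k (M b) := Module.compHom (M b) (algebraMap k k[G])
      have : IsScalarTower k k[G] (M b) := ⟨fun c x m => by
        rw [Algebra.smul_def, mul_smul]; rfl⟩
      exact ⟨M b, hM b hb, projective_of_smul_eq hbp (hMb b hb), rfl⟩
  · rintro b ⟨hb, -⟩ c ⟨hc, -⟩ h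
    obtain ⟨i⟩ := Quotient.exact h
    by_contra hne
    have h0 := hb.mul_eq_zero hc hne
    have := hM b hb
    have := IsSimpleModule.nontrivial k[G] (M b)
    obtain ⟨m, hm⟩ := exists_ne (0 : M b)
    apply hm
    have hcm : c • m = m := i.toLinearEquiv.injective (by rw [map_smul, hMb c hc])
    rw [← hMb b hb m, ← hcm, ← mul_smul, h0, zero_smul]

theorem defectZeroCount_iff [IsAlgClosed k] (n : ℕ) :
    DefectZeroCount k G n ↔ {b : k[G] | IsBlock b ∧ b ∈ projCenter k G}.encard = n := by
  rw [DefectZeroCount, numBlocksDefectZero_eq, z_eq, and_self]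

end Count

/-! ### Coefficients of the projective centre in characteristic two. -/

/-- Some involution commutes with `g`. -/
def CentralizedByInvolution {G : Type*} [Group G] (g : G) : Prop :=
  ∃ t : G, t ≠ 1 ∧ t * t = 1 ∧ t * g = g * t

section Coefficients

variable {k : Type u} [Field k] {G : Type v} [Group G]

theorem coeff_conj_of_mem_center {z : k[G]} (hz : z ∈ Subalgebra.center k k[G]) (g h : G) :
    z.coeff (g * h * g⁻¹) = z.coeff h := by
  have := congrArg (fun x : k[G] => x.coeff (g * h)) (Subalgebra.mem_center_iff.1 hz (single g 1))
  simpa [coeff_single_mul_apply, coeff_mul_single_apply] using this.symm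

theorem coeff_of_isConj {z : k[G]} (hz : z ∈ Subalgebra.center k k[G]) {g h : G}
    (hc : IsConj g h) : z.coeff g = z.coeff h := by
  obtain ⟨c, rfl⟩ := isConj_iff.1 hc
  rw [coeff_conj_of_mem_center hz]

/-- The sum in the group algebra of a finite set of group elements. -/
noncomputable def setSum (k : Type u) [Field k] (S : Finset G) : k[G] := ∑ x ∈ S, single x 1

omit [Group G] in
theorem coeff_setSum [DecidableEq G] (S : Finset G) (g : G) :
    (setSum k S).coeff g = if g ∈ S then 1 else 0 := by
  simp [setSum, coeff_sum, Finsupp.single_apply]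

theorem coeff_setSum_mul_setSum [DecidableEq G] (S T : Finset G) (g : G) :
    (setSum k S * setSum k T).coeff g = ({x ∈ S | x⁻¹ * g ∈ T}.card : k) := by
  rw [setSum, Finset.sum_mul, coeff_sum, Finsupp.finsetSum_apply, Finset.natCast_card_filter]
  refine Finset.sum_congr rfl fun x _ => ?_
  rw [coeff_single_mul_apply, coeff_setSum, one_mul]

variable [Fintype G]

theorem coeff_trace (a : k[G]) (h : G) :
    (trace k G a).coeff h = ∑ g : G, a.coeff (g⁻¹ * h * g) := by
  simp [trace_apply, coeff_sum, coeff_mul_single_apply, coeff_single_mul_apply, mul_assoc]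

variable [CharP k 2]

/-- Elements of the projective centre vanish on the elements commuting with an involution. -/
theorem coeff_eq_zero_of_centralized {z : k[G]} (hz : z ∈ projCenter k G) {h : G}
    (hh : CentralizedByInvolution h) : z.coeff h = 0 := by
  obtain ⟨a, rfl⟩ := hz
  obtain ⟨t, ht1, ht2, hth⟩ := hh
  have hti : t⁻¹ = t := inv_eq_of_mul_eq_one_right ht2
  rw [coeff_trace]
  have hinv : ∀ g : G, (t * g)⁻¹ * h * (t * g) = g⁻¹ * h * g := fun g => by
    rw [mul_inv_rev, hti, show g⁻¹ * t * h * (t * g) = g⁻¹ * (t * h * t) * g by group, hth,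
      mul_assoc h, ht2, mul_one]
  -- As t commutes with h, the terms at g and tg agree and cancel in pairs.
  refine Finset.sum_involution (fun g _ => t * g) (fun g _ => ?_) (fun g _ _ => ?_)
    (fun g _ => Finset.mem_univ _) (fun g _ => ?_)
  · rw [hinv, CharTwo.add_self_eq_zero]
  · simpa using ht1
  · rw [← mul_assoc, ht2, one_mul]

omit [CharP k 2] in
-- The conjugators form a coset of the centralizer of h, whose order is odd by Cauchy's theorem.
theorem odd_card_conjugators {h : G} (hh : ¬ CentralizedByInvolution h) [DecidableEq G] (y : G)
    (hy : IsConj h y) : Odd (Finset.card {g : G | g⁻¹ * h * g = y}) := by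
  obtain ⟨c, hc⟩ := isConj_iff.1 hy
  have hcard : Finset.card {g : G | g⁻¹ * h * g = y} =
      Nat.card (Subgroup.centralizer {h}) := by
    rw [← Fintype.card_subtype, ← Nat.card_eq_fintype_card]
    refine Nat.card_congr (Equiv.subtypeEquiv (Equiv.mulRight c) fun g => ?_)
    rw [Equiv.coe_mulRight, Subgroup.mem_centralizer_singleton_iff, ← hc]
    constructor
    · intro e
      have := congrArg (fun x => g * x * c) e
      simp only [mul_assoc, inv_mul_cancel, mul_one, mul_inv_cancel_left] at this
      simpa only [mul_assoc] using this.symm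
    · intro e
      have := congrArg (fun x => g⁻¹ * x * c⁻¹) e
      simp only [mul_assoc, mul_inv_cancel, mul_one, inv_mul_cancel_left] at this
      simpa only [mul_assoc] using this.symm
  rw [hcard, ← Nat.not_even_iff_odd, even_iff_two_dvd]
  intro h2
  obtain ⟨⟨t, ht⟩, ho⟩ := exists_prime_orderOf_dvd_card' 2 h2
  refine hh ⟨t, ?_, ?_, ?_⟩
  · rintro rfl
    rw [show (⟨1, ht⟩ : Subgroup.centralizer {h}) = 1 from rfl, orderOf_one] at ho
    omega
  · have := pow_orderOf_eq_one (⟨t, ht⟩ : Subgroup.centralizer {h})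
    rw [ho, pow_two] at this
    exact congrArg Subtype.val this
  · exact Subgroup.mem_centralizer_singleton_iff.1 ht

/-- Class functions vanishing on the elements that commute with an involution lie in the projective
centre. -/
theorem mem_projCenter_of_coeff {z : k[G]} (hz : z ∈ Subalgebra.center k k[G])
    (h0 : ∀ g, CentralizedByInvolution g → z.coeff g = 0) : z ∈ projCenter k G := by
  classical
  let rep : G → G := fun g => (Quotient.out (ConjClasses.mk g) : G)
  have hrep : ∀ g, IsConj g (rep g) := fun g =>
    (ConjClasses.mk_eq_mk_iff_isConj.1 (Quotient.out_eq (ConjClasses.mk g))).symm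
  have hrep2 : ∀ g h, IsConj g h → rep g = rep h := fun g h e => by
    simp only [rep, ConjClasses.mk_eq_mk_iff_isConj.2 e]
  -- a keeps z at one representative of each class. The coefficient of Tr(a) at h is z(h) times the
  -- number of conjugators, which is odd wherever z(h) may be nonzero.
  let a : k[G] := ∑ g ∈ Finset.univ.filter (fun g : G => rep g = g), single g (z.coeff g)
  have ha : ∀ g, a.coeff g = if rep g = g then z.coeff g else 0 := fun g => by
    simp [a, coeff_sum, Finsupp.single_apply]
  refine ⟨a, ?_⟩
  ext h
  rw [coeff_trace]
  have hterm : ∀ g : G, a.coeff (g⁻¹ * h * g) =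
      if g⁻¹ * h * g = rep h then z.coeff h else 0 := fun g => by
    have hc : IsConj h (g⁻¹ * h * g) := isConj_iff.2 ⟨g⁻¹, by simp⟩
    rw [ha, ← hrep2 _ _ hc, coeff_of_isConj hz hc]
    simp only [eq_comm]
  simp only [hterm]
  rw [← Finset.sum_filter, Finset.sum_const, nsmul_eq_mul]
  by_cases hh : CentralizedByInvolution h
  · rw [h0 h hh, mul_zero]
  · obtain ⟨n, hn⟩ := odd_card_conjugators hh _ (hrep h)
    rw [hn]
    push_cast
    rw [CharTwo.two_eq_zero, zero_mul, zero_add, one_mul]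

omit [CharP k 2] in
omit [Fintype G] in
theorem setSum_mem_center (S : Finset G) (hS : ∀ g, ∀ x ∈ S, g * x * g⁻¹ ∈ S) :
    setSum k S ∈ Subalgebra.center k k[G] := by
  classical
  refine mem_center_of_forall_of fun g => ?_
  ext h
  simp only [of_apply, coeff_single_mul_apply, coeff_mul_single_apply, coeff_setSum, one_mul,
    mul_one]
  refine if_congr ⟨fun e => ?_, fun e => ?_⟩ rfl rfl
  · simpa using hS g _ e
  · simpa [mul_assoc] using hS g⁻¹ _ e

theorem setSum_mem_projCenter (S : Finset G) (hS : ∀ g, ∀ x ∈ S, g * x * g⁻¹ ∈ S)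
    (hinv : ∀ x ∈ S, ¬ CentralizedByInvolution x) : setSum k S ∈ projCenter k G := by
  classical
  refine mem_projCenter_of_coeff (setSum_mem_center S hS) fun g hg => ?_
  rw [coeff_setSum, if_neg fun h => hinv g h hg]

end Coefficients

/-! ### Counting blocks inside the projective centre. -/

section Counting

variable {k : Type u} [Field k] [IsAlgClosed k] {G : Type} [Group G] [Fintype G]

theorem defectZeroCount_zero (h : ∀ z ∈ projCenter k G, z * z = z → z = 0) :
    DefectZeroCount k G 0 := by
  rw [defectZeroCount_iff, Nat.cast_zero, Set.encard_eq_zero, Set.eq_empty_iff_forall_notMem]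
  rintro b ⟨hb, hbp⟩
  exact hb.ne_zero (h b hbp hb.idem)

/-- The Fitting idempotent of a non-nilpotent z is nonzero, and a block below it is a multiple of z.
-/
theorem defectZeroCount_one (hle : ∀ b c : k[G], IsBlock b → IsBlock c → b ∈ projCenter k G →
      c ∈ projCenter k G → b = c)
    {z : k[G]} (hz : z ∈ projCenter k G) (hnil : ∀ n : ℕ, z ^ n ≠ 0) :
    DefectZeroCount k G 1 := by
  have hzc := projCenter_le_center hz
  obtain ⟨n, y, hy, hid, hfit⟩ := exists_fitting_idempotent hzc
  obtain ⟨b, hb, -, hbe⟩ := exists_isBlock_of_family (fun e : k[G] => e ≠ 0) (fun h => h rfl)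
    (fun e f _ _ he _ _ _ => by
      by_cases hf : f = 0
      · exact Or.inr (by simpa [hf] using he)
      · exact Or.inl hf)
    (mul_mem (pow_mem hzc _) hy) hid (fun h0 => hnil (n + 1) (by rw [← hfit, h0, mul_zero]))
  have hbp : b ∈ projCenter k G := by
    rw [← hbe, pow_succ, mul_assoc, mul_assoc, ← Subalgebra.mem_center_iff.1 hzc, ← mul_assoc]
    exact mul_mem_projCenter hz (mul_mem (pow_mem hzc _) (mul_mem hy hb.mem_center))
  rw [defectZeroCount_iff, Nat.cast_one, Set.encard_eq_one]
  exact ⟨b, Set.eq_singleton_iff_unique_mem.2 ⟨⟨hb, hbp⟩, fun c hc => hle _ _ hc.1 hb hc.2 hbp⟩⟩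

/-- The projective centre is then a copy of kⁿ, whose idempotents have coordinates 0 and 1; the
primitive ones are the fᵢ. -/
theorem defectZeroCount_of_orthogonal {n : ℕ} (f : Fin n → k[G]) (hf : ∀ i, f i ∈ projCenter k G)
    (hne : ∀ i, f i ≠ 0) (hidem : ∀ i, f i * f i = f i) (horth : ∀ i j, i ≠ j → f i * f j = 0)
    (hspan : ∀ z ∈ projCenter k G, ∃ c : Fin n → k, z = ∑ i, c i • f i) :
    DefectZeroCount k G n := by
  have hmul : ∀ (c : Fin n → k) i, f i * ∑ j, c j • f j = c i • f i := fun c i => by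
    rw [Finset.mul_sum, Finset.sum_eq_single i]
    · rw [mul_smul_comm, hidem]
    · intro j _ hj
      rw [mul_smul_comm, horth i j hj.symm, smul_zero]
    · simp
  have hcoef : ∀ (c : Fin n → k), (∑ j, c j • f j) * (∑ j, c j • f j) = ∑ j, c j • f j →
      ∀ i, c i = 0 ∨ c i = 1 := fun c hc i => by
    have h := congrArg (f i * ·) hc
    simp only [← mul_assoc, hmul] at h
    rw [smul_mul_assoc, hmul, smul_smul] at h
    have h2 := smul_left_injective k (hne i) h
    rcases eq_or_ne (c i) 0 with h0 | h0
    · exact Or.inl h0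
    · exact Or.inr (mul_left_cancel₀ h0 (by simpa using h2))
  have hset : {b : k[G] | IsBlock b ∧ b ∈ projCenter k G} = Set.range f := by
    ext b
    constructor
    · rintro ⟨hb, hbp⟩
      obtain ⟨c, rfl⟩ := hspan b hbp
      have hc := hcoef c hb.idem
      have : ∃ i, c i = 1 := by
        by_contra! hno
        refine hb.ne_zero (Finset.sum_eq_zero fun i _ => ?_)
        rw [(hc i).resolve_right (hno i), zero_smul]
      obtain ⟨i, hi⟩ := this
      have hfi := projCenter_le_center (hf i)
      have h1 : (∑ j, c j • f j) * f i = f i := by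
        rw [Subalgebra.mem_center_iff.1 hfi, hmul, hi, one_smul]
      rcases hb.primitive (f i) hfi (hidem i) h1 with h | h
      · exact absurd h (hne i)
      · exact ⟨i, h⟩
    · rintro ⟨i, rfl⟩
      have hfi := projCenter_le_center (hf i)
      refine ⟨⟨hfi, hidem i, hne i, fun e he hee hfe => ?_⟩, hf i⟩
      -- The projective centre is an ideal of the centre, so primitivity need only be tested inside
      -- it.
      have hep : e ∈ projCenter k G := by
        rw [← hfe, Subalgebra.mem_center_iff.1 he]
        rw [Subalgebra.mem_center_iff.1 he] at hfe
        rw [hfe, ← hfe]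
        exact mul_mem_projCenter (hf i) he
      obtain ⟨c, rfl⟩ := hspan e hep
      rw [hmul] at hfe
      rcases hcoef c hee i with h | h
      · left; rw [← hfe, h, zero_smul]
      · right; rw [← hfe, h, one_smul]
  have hinj : Function.Injective f := fun i j hij => by
    by_contra hne'
    have h := horth i j hne'
    rw [← hij, hidem] at h
    exact hne i h
  rw [defectZeroCount_iff, hset, ← Set.image_univ, hinj.encard_image, Set.encard_univ]
  simp

end Counting

/-! ### Groups with one class of odd centralizer order. -/

section SingleClass

variable {k : Type u} [Field k] [IsAlgClosed k] [CharP k 2] {G : Type} [Group G] [Fintype G]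
  [DecidableEq G]

omit [IsAlgClosed k] in
-- The projective centre is at most one-dimensional here: its elements are class functions supported
-- on the single class S.
theorem eq_smul_setSum {S : Finset G} (hconj : ∀ x ∈ S, ∀ y ∈ S, IsConj x y)
    (hcompl : ∀ x ∉ S, CentralizedByInvolution x) {x₀ : G} (hx₀ : x₀ ∈ S) {z : k[G]}
    (hz : z ∈ projCenter k G) : z = z.coeff x₀ • setSum k S := by
  ext g
  rw [coeff_smul_apply, coeff_setSum]
  split_ifs with hg
  · rw [coeff_of_isConj (projCenter_le_center hz) (hconj g hg _ hx₀), smul_eq_mul, mul_one]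
  · rw [coeff_eq_zero_of_centralized hz (hcompl g hg), smul_zero]

/-- If just one class of `G` has centralizers of odd order and its structure constant is odd, there
is a single block of defect zero. -/
theorem defectZeroCount_one_of_odd (S : Finset G) (hconj : ∀ x ∈ S, ∀ y ∈ S, IsConj x y)
    (hS : ∀ g, ∀ x ∈ S, g * x * g⁻¹ ∈ S) (hinv : ∀ x ∈ S, ¬ CentralizedByInvolution x)
    (hcompl : ∀ x ∉ S, CentralizedByInvolution x) {x₀ : G} (hx₀ : x₀ ∈ S)
    (hodd : Odd {x ∈ S | x⁻¹ * x₀ ∈ S}.card) : DefectZeroCount k G 1 := by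
  have hc : setSum k S ∈ projCenter k G := setSum_mem_projCenter S hS hinv
  refine defectZeroCount_of_orthogonal (fun _ => setSum k S) (fun _ => hc) (fun _ h => ?_)
    (fun _ => ?_) (fun i j h => absurd (Subsingleton.elim i j) h) (fun z hz => ?_)
  · have := congrArg (fun x : k[G] => x.coeff x₀) h
    simp [coeff_setSum, hx₀] at this
  · rw [eq_smul_setSum hconj hcompl hx₀ (mul_mem_projCenter hc (projCenter_le_center hc)),
      coeff_setSum_mul_setSum]
    obtain ⟨n, hn⟩ := hodd
    rw [hn]
    push_cast
    rw [CharTwo.two_eq_zero, zero_mul, zero_add, one_smul]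
  · exact ⟨fun _ => z.coeff x₀, by simpa using eq_smul_setSum hconj hcompl hx₀ hz⟩

/-- If at most one class of `G` has centralizers of odd order and its structure constant is even,
there are no blocks of defect zero. -/
theorem defectZeroCount_zero_of_even (S : Finset G) (hconj : ∀ x ∈ S, ∀ y ∈ S, IsConj x y)
    (hinv : ∀ x ∈ S, ¬ CentralizedByInvolution x) (hS : ∀ g, ∀ x ∈ S, g * x * g⁻¹ ∈ S)
    (hcompl : ∀ x ∉ S, CentralizedByInvolution x)
    {x₀ : G} (hx₀ : x₀ ∈ S) (heven : Even {x ∈ S | x⁻¹ * x₀ ∈ S}.card) :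
    DefectZeroCount k G 0 := by
  have hc : setSum k S ∈ projCenter k G := setSum_mem_projCenter S hS hinv
  refine defectZeroCount_zero fun z hz hzz => ?_
  have hcc : setSum k S * setSum k S = 0 := by
    rw [eq_smul_setSum hconj hcompl hx₀ (mul_mem_projCenter hc (projCenter_le_center hc)),
      coeff_setSum_mul_setSum]
    obtain ⟨n, hn⟩ := heven
    rw [hn, Nat.cast_add, CharTwo.add_self_eq_zero, zero_smul]
  rw [← hzz, eq_smul_setSum hconj hcompl hx₀ hz, smul_mul_smul_comm, hcc, smul_zero]

end SingleClass

/-! ### Multiplication by the sum over a 2-subgroup. -/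

section SubgroupSum

variable {k : Type u} [Field k] {G : Type v} [Group G] [Fintype G]

/-- The sum in the group algebra of the elements of a subgroup. -/
noncomputable def subgroupSum (k : Type u) [Field k] (P : Subgroup G) : k[G] :=
  ∑ᶠ p : P, of k G p

variable {P : Subgroup G}

omit [Fintype G] in
theorem subgroupSum_eq [Fintype P] : subgroupSum k P = ∑ p : P, of k G p :=
  finsum_eq_sum_of_fintype _

omit [Fintype G] in
theorem coeff_mul_subgroupSum [Fintype P] (x : k[G]) (g : G) :
    (x * subgroupSum k P).coeff g = ∑ p : P, x.coeff (g * p) := by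
  rw [subgroupSum_eq, Finset.mul_sum, coeff_sum, Finsupp.finsetSum_apply]
  refine Fintype.sum_equiv (Equiv.inv P) _ _ fun p => ?_
  simp [coeff_mul_single_apply]

theorem coeff_subgroupSum [DecidablePred (· ∈ P)] (g : G) :
    (subgroupSum k P).coeff g = if g ∈ P then 1 else 0 := by
  have := Fintype.ofFinite P
  rw [subgroupSum_eq, coeff_sum, Finsupp.finsetSum_apply]
  split_ifs with hg
  · rw [Finset.sum_eq_single ⟨g, hg⟩]
    · simp
    · intro p _ hp
      simp only [of_apply, coeff_single]
      exact Finsupp.single_eq_of_ne fun h => hp (Subtype.ext h.symm)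
    · simp
  · refine Finset.sum_eq_zero fun p _ => ?_
    simp only [of_apply, coeff_single]
    exact Finsupp.single_eq_of_ne fun h => hg (h ▸ p.2)

theorem of_mul_subgroupSum {p : G} (hp : p ∈ P) :
    of k G p * subgroupSum k P = subgroupSum k P := by
  have := Fintype.ofFinite P
  rw [subgroupSum_eq, Finset.mul_sum]
  refine Fintype.sum_equiv (Equiv.mulLeft (⟨p, hp⟩ : P)) _ _ fun q => ?_
  simp

/-- The function on `G` given by a multiple of the subgroup sum with a central element is
constant on double cosets. -/
theorem coeff_mul_subgroupSum_biinvariant {z : k[G]} (hz : z ∈ Subalgebra.center k k[G])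
    {p q : G} (hp : p ∈ P) (hq : q ∈ P) (g : G) :
    (z * subgroupSum k P).coeff (p * g * q) = (z * subgroupSum k P).coeff g := by
  have := Fintype.ofFinite P
  have h1 : (z * subgroupSum k P).coeff (p * (g * q)) = (z * subgroupSum k P).coeff (g * q) := by
    conv_lhs =>
      rw [← of_mul_subgroupSum hp, ← mul_assoc, ← Subalgebra.mem_center_iff.1 hz, mul_assoc]
    simp [coeff_single_mul_apply]
  rw [mul_assoc, h1, coeff_mul_subgroupSum, coeff_mul_subgroupSum]
  refine Fintype.sum_equiv (Equiv.mulLeft (⟨q, hq⟩ : P)) _ _ fun r => ?_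
  simp [mul_assoc]

variable [CharP k 2]

/-- Multiples of the subgroup sum with an element of the projective centre vanish on the double
cosets `PgP` for which `P ∩ gPg⁻¹` contains an involution. -/
theorem coeff_mul_subgroupSum_eq_zero {z : k[G]} (hz : z ∈ projCenter k G) {g q : G}
    (hq : q ∈ P) (hq1 : q ≠ 1) (hq2 : q * q = 1) (hqg : g⁻¹ * q * g ∈ P) :
    (z * subgroupSum k P).coeff g = 0 := by
  have := Fintype.ofFinite P
  obtain ⟨a, rfl⟩ := hz
  have hqi : q⁻¹ = q := inv_eq_of_mul_eq_one_right hq2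
  rw [coeff_mul_subgroupSum]
  simp only [coeff_trace]
  rw [← Fintype.sum_prod_type' (fun (p : P) (h : G) => a.coeff (h⁻¹ * (g * p) * h))]
  let r : P := ⟨g⁻¹ * q * g, hqg⟩
  let s : P := ⟨q, hq⟩
  have hr : r * r = 1 := Subtype.ext (by
    change g⁻¹ * q * g * (g⁻¹ * q * g) = 1
    rw [show g⁻¹ * q * g * (g⁻¹ * q * g) = g⁻¹ * (q * q) * g by group, hq2]; simp)
  have hs : s * s = 1 := Subtype.ext hq2
  -- With r = g⁻¹qg one has g(rpq) = q(gp)q, so conjugating by qh undoes the change of p. The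
  -- pairing has no fixed point since q ≠ 1.
  refine Finset.sum_involution (fun x _ => (r * x.1 * s, q * x.2)) (fun x _ => ?_)
    (fun x _ _ e => hq1 ?_) (fun x _ => Finset.mem_univ _) (fun x _ => ?_)
  · have : (q * x.2)⁻¹ * (g * ((r * x.1 * s : P) : G)) * (q * x.2) = x.2⁻¹ * (g * x.1) * x.2 := by
      change (q * x.2)⁻¹ * (g * (g⁻¹ * q * g * x.1 * q)) * (q * x.2) = _
      rw [mul_inv_rev, show x.2⁻¹ * q⁻¹ * (g * (g⁻¹ * q * g * x.1 * q)) * (q * x.2) =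
        x.2⁻¹ * (g * x.1 * (q * q)) * x.2 by group, hq2, mul_one]
    simp only [this]
    exact CharTwo.add_self_eq_zero _
  · simpa using congrArg Prod.snd e
  · ext1
    · change r * (r * x.1 * s) * s = x.1
      rw [show r * (r * x.1 * s) * s = (r * r) * x.1 * (s * s) by group, hr, hs, one_mul, mul_one]
    · change q * (q * x.2) = x.2
      rw [← mul_assoc, hq2, one_mul]

/-- A nonzero left ideal element generates, under a finite `2`-group in characteristic two, a
module with nonzero fixed points. -/
theorem exists_fixed_of_isPGroup (hP : IsPGroup 2 P) {b : k[G]} (hb : b ≠ 0) :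
    ∃ y : k[G], y * b ≠ 0 ∧ ∀ p ∈ P, of k G p * (y * b) = y * b := by
  -- The field is infinite, so the fixed-point count for 2-groups is applied to the additive span of
  -- the translates of b. It is finite of even order, so 0 is not the only fixed point.
  let W : AddSubgroup k[G] := AddSubgroup.closure (Set.range fun g : G => of k G g * b)
  have hW : ∀ w ∈ W, ∃ y, w = y * b := fun w hw => by
    induction hw using AddSubgroup.closure_induction with
    | mem x hx => obtain ⟨g, rfl⟩ := hx; exact ⟨_, rfl⟩
    | zero => exact ⟨0, by simp⟩
    | add x y _ _ hx hy =>
      obtain ⟨⟨c, rfl⟩, ⟨d, rfl⟩⟩ := And.intro hx hy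
      exact ⟨c + d, (add_mul c d b).symm⟩
    | neg x _ hx => obtain ⟨c, rfl⟩ := hx; exact ⟨-c, by simp⟩
  have hact : ∀ p : G, ∀ w ∈ W, of k G p * w ∈ W := fun p w hw => by
    induction hw using AddSubgroup.closure_induction with
    | mem x hx =>
      obtain ⟨g, rfl⟩ := hx
      exact AddSubgroup.subset_closure ⟨p * g, by simp [← mul_assoc, single_mul_single]⟩
    | zero => simp
    | add x y _ _ hx hy => rw [mul_add]; exact W.add_mem hx hy
    | neg x _ hx => rw [mul_neg]; exact W.neg_mem hx
  have h2 : ∀ x : k[G], x + x = 0 := fun x => by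
    rw [← two_smul k, CharTwo.two_eq_zero, zero_smul]
  have : AddGroup.FG W := by
    rw [AddGroup.fg_iff_addSubgroup_fg, AddSubgroup.fg_iff]
    exact ⟨_, rfl, Set.finite_range _⟩
  have : Finite W := AddCommGroup.finite_of_fg_isAddTorsion W fun w =>
    isOfFinAddOrder_iff_nsmul_eq_zero.2 ⟨2, two_pos, by
      rw [two_nsmul]; exact Subtype.ext (h2 w)⟩
  let _ : MulAction P W :=
    { smul := fun p w => ⟨of k G p * w, hact p w w.2⟩
      one_smul := fun w => Subtype.ext (by change of k G 1 * (w : k[G]) = w; rw [map_one, one_mul])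
      mul_smul := fun p q w => Subtype.ext (by
        change of k G (p * q : G) * (w : k[G]) = of k G p * (of k G q * w)
        rw [map_mul, mul_assoc]) }
  have hbW : b ∈ W := AddSubgroup.subset_closure ⟨1, by simp [← one_def]⟩
  have hcard : 2 ∣ Nat.card W := by
    have h : addOrderOf (⟨b, hbW⟩ : W) = 2 :=
      addOrderOf_eq_prime (by rw [two_nsmul]; exact Subtype.ext (h2 b))
        (fun h => hb (congrArg Subtype.val h))
    exact h ▸ addOrderOf_dvd_natCard _
  obtain ⟨w, hw, hne⟩ := hP.exists_fixed_point_of_prime_dvd_card_of_fixed_point W hcard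
    (a := (0 : W)) (fun p => Subtype.ext (mul_zero _))
  obtain ⟨y, hy⟩ := hW w w.2
  refine ⟨y, fun h => hne (Subtype.ext (by rw [hy, h]; rfl)), fun p hp => ?_⟩
  rw [← hy]
  exact congrArg Subtype.val (hw ⟨p, hp⟩)

/-- Nonzero idempotents of the projective centre are not annihilated by the sum over a
`2`-subgroup. -/
theorem mul_subgroupSum_ne_zero (hP : IsPGroup 2 P) {b : k[G]} (hb : b ∈ projCenter k G)
    (hbb : b * b = b) (hb0 : b ≠ 0) : b * subgroupSum k P ≠ 0 := by
  classical
  intro h0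
  have := Fintype.ofFinite P
  obtain ⟨y, hy0, hy⟩ := exists_fixed_of_isPGroup hP hb0
  have hbc := Subalgebra.mem_center_iff.1 (projCenter_le_center hb)
  set m := y * b with hm
  have hbm : b * m = m := by rw [hm, ← hbc, mul_assoc, hbb]
  obtain ⟨a, ha⟩ := hb
  -- Since b = Tr(a), m = bm = ∑ g⁻¹agm. Writing g = qp with p in P and using pm = m, the sum over p
  -- factors out as P̂. Then bP̂ = 0 would force m = bm = 0.
  have key : ∃ w, m = subgroupSum k P * w := by
    refine ⟨∑ q : G ⧸ P, of k G q.out⁻¹ * (a * (of k G q.out * m)), ?_⟩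
    have h1 : m = ∑ g : G, of k G g⁻¹ * (a * (of k G g * m)) := by
      conv_lhs => rw [← hbm, ← ha, trace_apply, Finset.sum_mul]
      refine Fintype.sum_equiv (Equiv.inv G) _ _ fun g => ?_
      simp only [Equiv.inv_apply, inv_inv, mul_assoc]
    have h2 : subgroupSum k P = ∑ p : P, of k G (p : G)⁻¹ := by
      rw [subgroupSum_eq]
      exact Fintype.sum_equiv (Equiv.inv P) _ _ fun p => by simp
    rw [h2, Finset.sum_mul_sum]
    conv_lhs => rw [h1]
    rw [Finset.sum_comm, ← Fintype.sum_prod_type'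
      (fun (q : G ⧸ P) (p : P) => of k G (p : G)⁻¹ * (of k G q.out⁻¹ * (a * (of k G q.out * m))))]
    refine (Fintype.sum_bijective (fun x : (G ⧸ P) × P => x.1.out * (x.2 : G)) ⟨?_, ?_⟩ _ _
      fun x => ?_).symm
    · rintro ⟨q, p⟩ ⟨q', p'⟩ h
      have hq : q = q' := by
        have := congrArg (QuotientGroup.mk (s := P)) h
        simpa [QuotientGroup.mk_mul_of_mem] using this
      subst hq
      simpa using h
    · intro g
      obtain ⟨p, hp⟩ := QuotientGroup.mk_out_eq_mul P g
      exact ⟨(g, p⁻¹), by simp [hp]⟩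
    · rw [mul_inv_rev, map_mul, map_mul, mul_assoc, mul_assoc (of k G x.1.out),
        hy _ x.2.2]
  obtain ⟨w, hw⟩ := key
  apply hy0
  rw [← hbm, hw, ← mul_assoc, h0, zero_mul]

end SubgroupSum

/-! ### Blocks detected on a single double coset. -/

section Regular

variable {k : Type u} [Field k] [IsAlgClosed k] [CharP k 2] {G : Type} [Group G] [Fintype G]

/-- If `PwP` is the only double coset of a `2`-subgroup `P` of size `|P|²`, and the two given
numbers are odd, there is a single block of defect zero. -/
theorem defectZeroCount_one_of_doubleCoset [DecidableEq G] (P : Subgroup G) [Fintype P]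
    (hP : IsPGroup 2 P) (w : G)
    (hreg : ∀ g, (∃ q ∈ P, q ≠ 1 ∧ q * q = 1 ∧ g⁻¹ * q * g ∈ P) ∨
      ∃ p ∈ P, ∃ q ∈ P, g = p * w * q)
    (hw : ∀ p ∈ P, w⁻¹ * p * w ∈ P → p = 1)
    (X : Finset G) (hX : ∀ g, ∀ x ∈ X, g * x * g⁻¹ ∈ X)
    (hXinv : ∀ x ∈ X, ¬ CentralizedByInvolution x)
    (hodd : Odd (Finset.card {p : P | w * p ∈ X}))
    (D : Set G) [DecidablePred (· ∈ D)] (hD : ∀ g, g ∈ D ↔ ∃ p ∈ P, ∃ q ∈ P, g = p * w * q)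
    (hodd' : Odd (Finset.card {p : P | w * p * w⁻¹ ∈ D})) : DefectZeroCount k G 1 := by
  classical
  -- Multiples of P̂ by the projective centre vanish off PwP and are constant on it, so any two are
  -- proportional.
  have hext : ∀ z ∈ projCenter k G, ∀ y ∈ projCenter k G, ∀ g,
      (z * subgroupSum k P).coeff w * (y * subgroupSum k P).coeff g =
      (y * subgroupSum k P).coeff w * (z * subgroupSum k P).coeff g := by
    intro z hz y hy g
    rcases hreg g with ⟨q, hq, hq1, hq2, hqg⟩ | ⟨p, hp, q, hq, rfl⟩
    · rw [coeff_mul_subgroupSum_eq_zero hz hq hq1 hq2 hqg,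
        coeff_mul_subgroupSum_eq_zero hy hq hq1 hq2 hqg, mul_zero, mul_zero]
    · rw [coeff_mul_subgroupSum_biinvariant (projCenter_le_center hz) hp hq,
        coeff_mul_subgroupSum_biinvariant (projCenter_le_center hy) hp hq, mul_comm]
  have hzX : setSum k X ∈ projCenter k G := setSum_mem_projCenter X hX hXinv
  have hcast : ∀ n : ℕ, Odd n → (n : k) = 1 := by
    rintro _ ⟨n, rfl⟩
    push_cast
    rw [CharTwo.two_eq_zero, zero_mul, zero_add]
  refine defectZeroCount_one (fun b c hb hc hbp hcp => ?_) hzX ?_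
  · by_contra hne
    have hbw : (b * subgroupSum k P).coeff w ≠ 0 := fun h0 => by
      refine mul_subgroupSum_ne_zero hP hbp hb.idem hb.ne_zero ?_
      ext g
      rcases hreg g with ⟨q, hq, hq1, hq2, hqg⟩ | ⟨p, hp, q, hq, rfl⟩
      · rw [coeff_mul_subgroupSum_eq_zero hbp hq hq1 hq2 hqg]; rfl
      · rw [coeff_mul_subgroupSum_biinvariant (projCenter_le_center hbp) hp hq, h0]; rfl
    have hrel : (b * subgroupSum k P).coeff w • (c * subgroupSum k P) =
        (c * subgroupSum k P).coeff w • (b * subgroupSum k P) := by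
      ext g
      exact hext b hbp c hcp g
    -- Multiplying the proportionality of bP̂ and cP̂ by c kills bP̂ but leaves a nonzero multiple
    -- of cP̂.
    have h1 := congrArg (c * ·) hrel
    simp only [mul_smul_comm, ← mul_assoc, hc.idem, hc.mul_eq_zero hb (Ne.symm hne), zero_mul,
      smul_zero] at h1
    exact (smul_ne_zero hbw (mul_subgroupSum_ne_zero hP hcp hc.idem hc.ne_zero)) h1
  · set z := setSum k X
    set y := z * subgroupSum k P with hy
    have hyw : y.coeff w = 1 := by
      rw [hy, coeff_mul_subgroupSum]
      simp only [z, coeff_setSum]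
      rw [← Finset.natCast_card_filter]
      exact hcast _ hodd
    have hyD : ∀ g, y.coeff g = if g ∈ D then 1 else 0 := fun g => by
      split_ifs with hg
      · obtain ⟨p, hp, q, hq, rfl⟩ := (hD g).1 hg
        rw [hy, coeff_mul_subgroupSum_biinvariant (projCenter_le_center hzX) hp hq, ← hy, hyw]
      · rcases hreg g with ⟨q, hq, hq1, hq2, hqg⟩ | h
        · exact coeff_mul_subgroupSum_eq_zero hzX hq hq1 hq2 hqg
        · exact absurd ((hD g).2 h) hg
    -- By `hw` each element of PwP has a unique expression pwq, so P̂wP̂ is the sum over the double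
    -- coset.
    have hyP : y = subgroupSum k P * of k G w * subgroupSum k P := by
      ext g
      rw [hyD, coeff_mul_subgroupSum]
      have hco : ∀ h, (subgroupSum k P * of k G w).coeff h =
          if h * w⁻¹ ∈ (P : Set G) then 1 else 0 := fun h => by
        rw [of_apply, coeff_mul_single_apply, coeff_subgroupSum, mul_one]
        rfl
      simp only [hco, SetLike.mem_coe]
      split_ifs with hg
      · obtain ⟨p, hp, q, hq, rfl⟩ := (hD g).1 hg
        rw [Finset.sum_eq_single (⟨q, hq⟩⁻¹ : P)]
        · simp [hp]
        · intro r _ hr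
          refine if_neg fun hmem => hr ?_
          have h1 : w * (q * r) * w⁻¹ ∈ P := by
            have := P.mul_mem (P.inv_mem hp) hmem
            rwa [show p⁻¹ * (p * w * q * r * w⁻¹) = w * (q * r) * w⁻¹ by group] at this
          have h2 := hw _ h1 (by
            rw [show w⁻¹ * (w * (q * r) * w⁻¹) * w = q * r by group]
            exact P.mul_mem hq r.2)
          have h3 : q * r = 1 := by
            have := congrArg (fun x => w⁻¹ * x * w) h2
            rwa [show w⁻¹ * (w * (q * r) * w⁻¹) * w = q * r by group, mul_one,
              inv_mul_cancel] at this
          exact eq_inv_of_mul_eq_one_right (Subtype.ext h3)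
        · simp
      · refine (Finset.sum_eq_zero fun p _ => if_neg fun hmem => hg ?_).symm
        exact (hD g).2 ⟨_, hmem, _, P.inv_mem p.2, by group⟩
    -- z²P̂ = zP̂wP̂ = ywP̂, whose coefficient at w is the second odd number. Hence z fixes y ≠ 0
    -- and is not nilpotent.
    have hyy : z * y = y := by
      have hzz := mul_mem_projCenter hzX (projCenter_le_center hzX)
      have hzy : (z * z * subgroupSum k P).coeff w = 1 := by
        rw [mul_assoc, ← hy, hyP, ← mul_assoc, ← mul_assoc, ← hy, coeff_mul_subgroupSum]
        have hco : ∀ p : P, (y * of k G w).coeff (w * p) =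
            if w * p * w⁻¹ ∈ D then 1 else 0 := fun p => by
          rw [of_apply, coeff_mul_single_apply, mul_one, hyD]
        simp only [hco]
        rw [← Finset.natCast_card_filter]
        exact hcast _ hodd'
      ext g
      have := hext z hzX (z * z) hzz g
      rw [← hy, hyw, hzy, one_mul, one_mul, mul_assoc, ← hy] at this
      exact this
    intro n h0
    have hn : ∀ n : ℕ, z ^ n * y = y := fun n => by
      induction n with
      | zero => simp
      | succ n ih => rw [pow_succ, mul_assoc, hyy, ih]
    have := hn n
    rw [h0, zero_mul] at this
    rw [← this] at hyw
    simp at hyw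

end Regular

/-! ### Counting permutations -/

/-- The transposition of `0` and `p` on natural numbers. -/
def swapZero (p i : ℕ) : ℕ := bif i == 0 then p else bif i == p then 0 else i

/-- The permutations of `{0, …, n - 1}` as lists of values. -/
def permLists : ℕ → List (List ℕ)
  | 0 => [[]]
  | n + 1 => (List.range (n + 1)).flatMap fun p =>
      (permLists n).map fun l => p :: l.map fun i => swapZero p (i + 1)

/-- The list of values of a permutation. -/
def valueList {n : ℕ} (x : Sym n) : List ℕ := List.ofFn fun i => (x i : ℕ)

/-- `decomposeFin` shifts e to fix 0 and then swaps 0 with p; `permLists` follows the same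
recursion. -/
theorem valueList_decomposeFin {n : ℕ} (p : Fin (n + 1)) (e : Sym n) :
    valueList (Equiv.Perm.decomposeFin.symm (p, e)) =
      (p : ℕ) :: (valueList e).map fun i => swapZero p (i + 1) := by
  rw [valueList, List.ofFn_succ, valueList, List.map_ofFn]
  congr 1
  · simp
  · congr 1
    funext i
    simp only [Equiv.Perm.decomposeFin_symm_apply_succ, Function.comp_apply, swapZero,
      Equiv.swap_apply_def, Fin.ext_iff, Fin.val_succ, Fin.val_zero]
    by_cases h : (e i : ℕ) + 1 = p
    · have h0 : (p : ℕ) ≠ 0 := by omega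
      simp [h, beq_eq_false_iff_ne.2 h0]
    · simp [h, beq_eq_false_iff_ne.2 h]

/-- This moves a count over permutations to lists of numerals, on which the kernel can evaluate it.
-/
theorem sum_permLists {n : ℕ} (t : List ℕ → Bool) :
    ∑ x : Sym n, (if t (valueList x) = true then 1 else 0) = (permLists n).countP t := by
  induction n generalizing t with
  | zero => simp [permLists, valueList, List.countP_cons]
  | succ n ih =>
    rw [← Equiv.sum_comp Equiv.Perm.decomposeFin.symm, Fintype.sum_prod_type]
    simp only [valueList_decomposeFin]
    have : ∀ p : Fin (n + 1), ∑ e : Sym n,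
        (if t ((p : ℕ) :: (valueList e).map fun i => swapZero p (i + 1)) = true then 1 else 0) =
        (permLists n).countP fun l => t ((p : ℕ) :: l.map fun i => swapZero p (i + 1)) :=
      fun p => ih fun l => t ((p : ℕ) :: l.map fun i => swapZero p (i + 1))
    simp only [this]
    rw [Fin.sum_univ_def, permLists, List.countP_flatMap, ← List.map_coe_finRange_eq_range,
      List.map_map]
    simp [List.countP_map, Function.comp_def]

theorem card_filter_eq_countP {n : ℕ} (P : Sym n → Prop) [DecidablePred P] (t : List ℕ → Bool)
    (h : ∀ x, P x ↔ t (valueList x) = true) :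
    Finset.card {x : Sym n | P x} = (permLists n).countP t := by
  rw [Finset.card_filter, ← sum_permLists]
  exact Finset.sum_congr rfl fun x _ => if_congr (h x) rfl rfl

/-- The value at `i` of a permutation given by its list of values. -/
def valueAt (l : List ℕ) (i : ℕ) : ℕ := l.getD i 0

theorem valueAt_valueList {n : ℕ} (x : Sym n) (i : Fin n) : valueAt (valueList x) i = x i := by
  simp [valueAt, valueList, List.getD_eq_getElem?_getD]

/-- The value at `i` of the `m`-th power. -/
def powValueAt (l : List ℕ) : ℕ → ℕ → ℕ
  | 0, i => i
  | m + 1, i => powValueAt l m (valueAt l i)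

theorem powValueAt_valueList {n : ℕ} (x : Sym n) (m : ℕ) (i : Fin n) :
    powValueAt (valueList x) m i = (x ^ m) i := by
  induction m generalizing i with
  | zero => simp [powValueAt]
  | succ m ih => rw [powValueAt, valueAt_valueList, ih, pow_succ, Equiv.Perm.mul_apply]

/-- Test for a nontrivial permutation whose `m`-th power is trivial and which has `f` fixed
points. -/
def hasType (n m f : ℕ) (l : List ℕ) : Bool :=
  (List.range n).all (fun i => powValueAt l m i == i) &&
    (List.range n).countP (fun i => valueAt l i == i) == f

theorem all_range_iff {n : ℕ} (t : ℕ → Bool) :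
    (List.range n).all t = true ↔ ∀ i : Fin n, t i = true := by
  simp only [List.all_eq_true, List.mem_range]
  exact ⟨fun h i => h i i.2, fun h i hi => h ⟨i, hi⟩⟩

theorem hasType_iff {n m f : ℕ} (x : Sym n) :
    hasType n m f (valueList x) = true ↔
      x ^ m = 1 ∧ Fintype.card (Function.fixedPoints x) = f := by
  rw [hasType, Bool.and_eq_true, all_range_iff, beq_iff_eq]
  refine and_congr ?_ ?_
  · simp only [powValueAt_valueList, beq_iff_eq, Fin.val_inj, Equiv.ext_iff, Equiv.Perm.coe_one,
      id]
  · have : (List.range n).countP (fun i => valueAt (valueList x) i == i) =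
        Fintype.card (Function.fixedPoints x) := by
      rw [← List.map_coe_finRange_eq_range, List.countP_map, Function.comp_def]
      simp only [valueAt_valueList]
      rw [Fintype.card_subtype, List.countP_eq_length_filter, Finset.card_def, Finset.filter_val,
        Fin.univ_def, Multiset.filter_coe, Multiset.coe_card]
      congr 1
      refine List.filter_congr fun i _ => ?_
      rw [Bool.eq_iff_iff, beq_iff_eq, decide_eq_true_iff, Fin.val_inj]
      rfl
    rw [this]

/-- Test for `x * t = s * x`, on lists of values. -/
def intertwines (n : ℕ) (t s l : List ℕ) : Bool :=
  (List.range n).all fun i => valueAt l (valueAt t i) == valueAt s (valueAt l i)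

theorem intertwines_iff {n : ℕ} (t s x : Sym n) :
    intertwines n (valueList t) (valueList s) (valueList x) = true ↔ x * t = s * x := by
  rw [intertwines, all_range_iff]
  simp only [valueAt_valueList, beq_iff_eq, Fin.val_inj, Equiv.ext_iff, Equiv.Perm.mul_apply]

/-! ### Centralizers and the parity of structure constants. -/

section Centralizers

variable {G : Type*} [Group G] [Finite G]

theorem exists_involution_of_even_card {K : Subgroup G} (h : 2 ∣ Nat.card K) :
    ∃ t ∈ K, t ≠ 1 ∧ t * t = 1 := by
  obtain ⟨⟨t, ht⟩, ho⟩ := exists_prime_orderOf_dvd_card' 2 h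
  refine ⟨t, ht, ?_, ?_⟩
  · rintro rfl
    rw [show (⟨1, ht⟩ : K) = 1 from rfl, orderOf_one] at ho
    omega
  · have := pow_orderOf_eq_one (⟨t, ht⟩ : K)
    rw [ho, pow_two] at this
    exact congrArg Subtype.val this

theorem centralizedByInvolution_iff {g : G} :
    CentralizedByInvolution g ↔ Even (Nat.card (Subgroup.centralizer {g})) := by
  rw [even_iff_two_dvd]
  constructor
  · rintro ⟨t, ht1, ht2, ht⟩
    have hmem : t ∈ Subgroup.centralizer {g} := Subgroup.mem_centralizer_singleton_iff.2 ht
    have : orderOf (⟨t, hmem⟩ : Subgroup.centralizer {g}) = 2 :=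
      orderOf_eq_prime (by rw [pow_two]; exact Subtype.ext ht2)
        (fun h => ht1 (congrArg Subtype.val h))
    exact this ▸ orderOf_dvd_natCard _
  · intro h
    obtain ⟨t, ht, ht1, ht2⟩ := exists_involution_of_even_card h
    exact ⟨t, ht1, ht2, Subgroup.mem_centralizer_singleton_iff.1 ht⟩

/-- Elements of even order commute with an involution. -/
theorem centralizedByInvolution_of_even_orderOf {g : G} (h : 2 ∣ orderOf g) :
    CentralizedByInvolution g := by
  obtain ⟨n, hn⟩ := h
  have hpos := orderOf_pos g
  refine ⟨g ^ n, fun h1 => ?_, ?_, (Commute.pow_self g n).eq⟩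
  · have := Nat.le_of_dvd (by omega) (orderOf_dvd_of_pow_eq_one h1)
    omega
  · rw [← pow_add, ← two_mul, ← hn, pow_orderOf_eq_one]

omit [Finite G] in
theorem CentralizedByInvolution.of_isConj {g h : G} (hg : CentralizedByInvolution g)
    (hc : IsConj g h) : CentralizedByInvolution h := by
  obtain ⟨c, rfl⟩ := isConj_iff.1 hc
  obtain ⟨t, ht1, ht2, ht⟩ := hg
  refine ⟨c * t * c⁻¹, fun h => ht1 ?_, ?_, ?_⟩
  · simpa using h
  · rw [show c * t * c⁻¹ * (c * t * c⁻¹) = c * (t * t) * c⁻¹ by group, ht2]; simp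
  · rw [show c * t * c⁻¹ * (c * g * c⁻¹) = c * (t * g) * c⁻¹ by group, ht]; group

/-- For an involution `t` inverting `z`, the parity of a structure constant of a real
class is determined by the elements conjugating `t` to `z * t`. -/
theorem card_modEq_card_intertwining {G : Type*} [Group G] [Fintype G] [DecidableEq G]
    (C : G → Prop) [DecidablePred C] (hC : ∀ g x, C x → C (g * x * g⁻¹))
    (hCinv : ∀ x, C x → C x⁻¹) {z t : G} (ht : t * t = 1) (htz : t * z * t = z⁻¹) :
    (Even (Finset.card {x | C x ∧ C (x⁻¹ * z)}) ↔
      Even (Finset.card {x | x * t = z * t * x ∧ C x})) := by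
  have hti : t⁻¹ = t := inv_eq_of_mul_eq_one_right ht
  have hs : z * t * (z * t) = 1 := by
    rw [show z * t * (z * t) = z * (t * z * t) by group, htz, mul_inv_cancel]
  have hsi : (z * t)⁻¹ = z * t := inv_eq_of_mul_eq_one_right hs
  have hfix : ∀ x, z * t * x * t = x ↔ x * t = z * t * x := fun x => by
    rw [← mul_left_inj t, mul_assoc (z * t * x), ht, mul_one, eq_comm]
  -- The pairing sends a factorization z = xy to (ty⁻¹t)(tx⁻¹t), again a factorization of z; here
  -- ty⁻¹t = ztxt. Its fixed points are the x with xt = ztx.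
  have hstep : ∀ x, C x → C (x⁻¹ * z) → C (z * t * x * t) := fun x _ h => by
    have := hC t _ (hCinv _ h)
    rwa [hti, show t * (x⁻¹ * z)⁻¹ * t = (t * z⁻¹) * x * t by group,
      show t * z⁻¹ = z * t by rw [← htz, ← mul_assoc, ← mul_assoc, ht, one_mul]] at this
  have hstep' : ∀ x, C x → C (x⁻¹ * z) → C ((z * t * x * t)⁻¹ * z) := fun x h _ => by
    have := hC t _ (hCinv _ h)
    rwa [hti, show t * x⁻¹ * t = t⁻¹ * x⁻¹ * (z * t)⁻¹ * z by
      rw [hsi, hti, show t * x⁻¹ * (z * t) * z = t * x⁻¹ * z * (t * z * t) * t⁻¹ by group, htz]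
      simp [hti, mul_assoc], show t⁻¹ * x⁻¹ * (z * t)⁻¹ * z = (z * t * x * t)⁻¹ * z by group] at this
  have hsub : (Finset.univ.filter fun x : G => x * t = z * t * x ∧ C x) =
      (Finset.univ.filter fun x : G => C x ∧ C (x⁻¹ * z)).filter (fun x => z * t * x * t = x) := by
    ext x
    simp only [Finset.mem_filter, Finset.mem_univ, true_and, hfix]
    refine ⟨fun ⟨h1, h2⟩ => ⟨⟨h2, ?_⟩, h1⟩, fun ⟨⟨h2, _⟩, h1⟩ => ⟨h1, h2⟩⟩
    have := hC t _ (hCinv _ h2)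
    have h3 : x⁻¹ * z = t * x⁻¹ * t := by
      have h4 : x⁻¹ * (z * t) = t * x⁻¹ := by
        rw [inv_mul_eq_iff_eq_mul, ← mul_assoc, h1, mul_inv_cancel_right]
      rw [← h4, mul_assoc, mul_assoc, ht, mul_one]
    rwa [hti, ← h3] at this
  rw [hsub, ← Finset.card_filter_add_card_filter_not (fun x => z * t * x * t = x), Nat.even_add]
  have heven : Even (Finset.card ((Finset.univ.filter fun x : G => C x ∧ C (x⁻¹ * z)).filter
      (fun x => ¬ z * t * x * t = x))) := by
    rw [← ZMod.natCast_eq_zero_iff_even, Finset.card_eq_sum_ones, Nat.cast_sum]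
    refine Finset.sum_involution (fun x _ => z * t * x * t) (fun x _ => ?_) (fun x hx _ => ?_)
      (fun x hx => ?_) (fun x _ => ?_)
    · decide
    · exact (Finset.mem_filter.1 hx).2
    · simp only [Finset.mem_filter, Finset.mem_univ, true_and] at hx ⊢
      refine ⟨⟨hstep x hx.1.1 hx.1.2, hstep' x hx.1.1 hx.1.2⟩, fun h => hx.2 ?_⟩
      have h5 := mul_right_cancel h
      exact mul_left_cancel h5
    · rw [show z * t * (z * t * x * t) * t = (z * t * (z * t)) * x * (t * t) by group, hs, ht]
      simp
  simp [heven]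

end Centralizers

/-! ### Cycle types and centralizer orders. -/

section CycleTypes

open Nat in
/-- The order of the centralizer in the symmetric group of degree `n` of a permutation with the
given cycle type. -/
def centralizerCard (n : ℕ) (m : Multiset ℕ) : ℕ :=
  (n - m.sum)! * m.prod * ∏ c ∈ m.toFinset, (m.count c)!

theorem card_centralizer_eq {n : ℕ} (x : Sym n) :
    Nat.card (Subgroup.centralizer {x}) = centralizerCard n x.cycleType := by
  rw [Equiv.Perm.nat_card_centralizer, Fintype.card_fin, centralizerCard]

theorem centralizedByInvolution_perm_iff {n : ℕ} {x : Sym n} :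
    CentralizedByInvolution x ↔ Even (centralizerCard n x.cycleType) := by
  rw [centralizedByInvolution_iff, card_centralizer_eq]

/-- Four parts of size at least 2 already sum to 8. -/
theorem Multiset.cases_of_sum_le_seven {m : Multiset ℕ} (h2 : ∀ a ∈ m, 2 ≤ a) (hs : m.sum ≤ 7) :
    m = 0 ∨ (∃ a, 2 ≤ a ∧ a ≤ m.sum ∧ m = {a}) ∨
      (∃ a b, 2 ≤ a ∧ 2 ≤ b ∧ a + b ≤ m.sum ∧ m = {a, b}) ∨
      (∃ a b c, 2 ≤ a ∧ 2 ≤ b ∧ 2 ≤ c ∧ a + b + c ≤ m.sum ∧ m = {a, b, c}) := by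
  induction m using Quotient.inductionOn with
  | _ l =>
  match l with
  | [] => exact Or.inl rfl
  | [a] => exact Or.inr (Or.inl ⟨a, h2 a (by simp), by simp, rfl⟩)
  | [a, b] => exact Or.inr (Or.inr (Or.inl ⟨a, b, h2 a (by simp), h2 b (by simp), by simp, rfl⟩))
  | [a, b, c] => exact Or.inr (Or.inr (Or.inr ⟨a, b, c, h2 a (by simp), h2 b (by simp),
      h2 c (by simp), by simp [add_assoc], rfl⟩))
  | a :: b :: c :: d :: l =>
    have ha := h2 a (by simp)
    have hb := h2 b (by simp)
    have hc := h2 c (by simp)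
    have hd := h2 d (by simp)
    simp at hs
    omega

theorem cycleType_cases {n : ℕ} (hn : n ≤ 7) (x : Sym n) :
    x.cycleType = 0 ∨ (∃ a, 2 ≤ a ∧ a ≤ n ∧ x.cycleType = {a}) ∨
      (∃ a b, 2 ≤ a ∧ 2 ≤ b ∧ a + b ≤ n ∧ x.cycleType = {a, b}) ∨
      (∃ a b c, 2 ≤ a ∧ 2 ≤ b ∧ 2 ≤ c ∧ a + b + c ≤ n ∧ x.cycleType = {a, b, c}) := by
  have hle : x.cycleType.sum ≤ n := by simpa using x.sum_cycleType_le
  rcases Multiset.cases_of_sum_le_seven (fun a => Equiv.Perm.two_le_of_mem_cycleType)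
    (hle.trans hn) with h | ⟨a, h1, h2, h⟩ | ⟨a, b, h1, h2, h3, h⟩ | ⟨a, b, c, h1, h2, h3, h4, h⟩
  · exact Or.inl h
  · exact Or.inr (Or.inl ⟨a, h1, h2.trans hle, h⟩)
  · exact Or.inr (Or.inr (Or.inl ⟨a, b, h1, h2, h3.trans hle, h⟩))
  · exact Or.inr (Or.inr (Or.inr ⟨a, b, c, h1, h2, h3, h4.trans hle, h⟩))

/-- When p is prime, xᵖ = 1 makes every nontrivial cycle a p-cycle, and the fixed points then
determine their number. This turns a cycle type into a test on value lists. -/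
theorem cycleType_eq_replicate_iff {n p j f : ℕ} (hp : p.Prime) (hn : n = j * p + f) (x : Sym n) :
    x.cycleType = Multiset.replicate j p ↔
      x ^ p = 1 ∧ Fintype.card (Function.fixedPoints x) = f := by
  have := Fact.mk hp
  rw [Equiv.Perm.card_fixedPoints, Fintype.card_fin, Equiv.Perm.pow_prime_eq_one_iff]
  have hle : x.cycleType.sum ≤ n := by simpa using x.sum_cycleType_le
  constructor
  · intro h
    rw [h, Multiset.sum_replicate, smul_eq_mul]
    exact ⟨fun c hc => Multiset.eq_of_mem_replicate hc, by omega⟩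
  · rintro ⟨h1, h2⟩
    have h3 := Multiset.eq_replicate_card.2 h1
    rw [h3, Multiset.sum_replicate, smul_eq_mul] at h2 hle
    have : Multiset.card x.cycleType * p = j * p := by omega
    rw [h3, Nat.eq_of_mul_eq_mul_right hp.pos this]

/-- The parity of a structure constant between two classes of permutations of prime order. -/
theorem even_structureConstant_iff {n p j f : ℕ} (hp : p.Prime) (hn : n = j * p + f)
    {z t : Sym n} (ht : t * t = 1) (htz : t * z * t = z⁻¹) {lt ls : List ℕ}
    (hlt : valueList t = lt) (hls : valueList (z * t) = ls) :
    Even (Finset.card {x : Sym n | x.cycleType = Multiset.replicate j p ∧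
      (x⁻¹ * z).cycleType = Multiset.replicate j p}) ↔
    Even ((permLists n).countP fun l => intertwines n lt ls l && hasType n p f l) := by
  rw [card_modEq_card_intertwining (fun x : Sym n => x.cycleType = Multiset.replicate j p)
    (fun g x h => by rw [Equiv.Perm.cycleType_conj, h])
    (fun x h => by rw [Equiv.Perm.cycleType_inv, h]) ht htz,
    card_filter_eq_countP _ (fun l => intertwines n lt ls l && hasType n p f l)]
  intro x
  rw [Bool.and_eq_true, ← hlt, ← hls, intertwines_iff, hasType_iff,
    cycleType_eq_replicate_iff hp hn]

end CycleTypes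

/-! ### The symmetric groups. -/

section Symmetric

variable {k : Type*} [Field k] [IsAlgClosed k] [CharP k 2]

theorem centralizedByInvolution_of_cycleType_ne {n a : ℕ} (hn : n ≤ 7)
    (h : ∀ m : Multiset ℕ, m = 0 ∨ (∃ a, 2 ≤ a ∧ a ≤ n ∧ m = {a}) ∨
      (∃ a b, 2 ≤ a ∧ 2 ≤ b ∧ a + b ≤ n ∧ m = {a, b}) ∨
      (∃ a b c, 2 ≤ a ∧ 2 ≤ b ∧ 2 ≤ c ∧ a + b + c ≤ n ∧ m = {a, b, c}) →
      Even (centralizerCard n m) ∨ m = {a}) {x : Sym n} (hx : x.cycleType ≠ {a}) :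
    CentralizedByInvolution x :=
  centralizedByInvolution_perm_iff.2 ((h _ (cycleType_cases hn x)).resolve_right hx)

theorem defectZeroCount_sym_of_odd {n p f : ℕ} (hp : p.Prime) (hn : n = 1 * p + f)
    (hodd : ¬ Even (centralizerCard n {p}))
    (hcompl : ∀ x : Sym n, x.cycleType ≠ {p} → CentralizedByInvolution x)
    {z t : Sym n} (hz : z.cycleType = {p}) (ht : t * t = 1) (htz : t * z * t = z⁻¹) {lt ls : List ℕ}
    (hlt : valueList t = lt) (hls : valueList (z * t) = ls)
    (hcount : ¬ Even ((permLists n).countP fun l => intertwines n lt ls l && hasType n p f l)) :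
    DefectZeroCount k (Sym n) 1 := by
  refine defectZeroCount_one_of_odd (Finset.univ.filter fun x : Sym n => x.cycleType = {p})
    ?_ ?_ ?_ ?_ (x₀ := z) (by simpa using hz) ?_
  · intro x hx y hy
    rw [Finset.mem_filter] at hx hy
    rw [Equiv.Perm.isConj_iff_cycleType_eq, hx.2, hy.2]
  · intro g x hx
    simpa [Equiv.Perm.cycleType_conj] using hx
  · intro x hx
    rw [centralizedByInvolution_perm_iff, (Finset.mem_filter.1 hx).2]
    exact hodd
  · intro x hx
    exact hcompl x (by simpa using hx)
  · rw [← Nat.not_even_iff_odd, Finset.filter_filter]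
    simp only [Finset.mem_filter, Finset.mem_univ, true_and]
    rw [← even_structureConstant_iff hp hn ht htz hlt hls, Multiset.replicate_one] at hcount
    exact hcount

theorem defectZeroCount_sym_of_even {n p f : ℕ} (hp : p.Prime) (hn : n = 1 * p + f)
    (hodd : ¬ Even (centralizerCard n {p}))
    (hcompl : ∀ x : Sym n, x.cycleType ≠ {p} → CentralizedByInvolution x)
    {z t : Sym n} (hz : z.cycleType = {p}) (ht : t * t = 1) (htz : t * z * t = z⁻¹) {lt ls : List ℕ}
    (hlt : valueList t = lt) (hls : valueList (z * t) = ls)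
    (hcount : Even ((permLists n).countP fun l => intertwines n lt ls l && hasType n p f l)) :
    DefectZeroCount k (Sym n) 0 := by
  refine defectZeroCount_zero_of_even (Finset.univ.filter fun x : Sym n => x.cycleType = {p})
    ?_ ?_ ?_ ?_ (x₀ := z) (by simpa using hz) ?_
  · intro x hx y hy
    rw [Finset.mem_filter] at hx hy
    rw [Equiv.Perm.isConj_iff_cycleType_eq, hx.2, hy.2]
  · intro x hx
    rw [centralizedByInvolution_perm_iff, (Finset.mem_filter.1 hx).2]
    exact hodd
  · intro g x hx
    simpa [Equiv.Perm.cycleType_conj] using hx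
  · intro x hx
    exact hcompl x (by simpa using hx)
  · rw [Finset.filter_filter]
    simp only [Finset.mem_filter, Finset.mem_univ, true_and]
    rw [← even_structureConstant_iff hp hn ht htz hlt hls, Multiset.replicate_one] at hcount
    exact hcount

theorem centralizedByInvolution_sym_three {x : Sym 3} (hx : x.cycleType ≠ {3}) :
    CentralizedByInvolution x := by
  refine centralizedByInvolution_of_cycleType_ne (by norm_num) (fun m h => ?_) hx
  rcases h with rfl | ⟨a, h1, h2, rfl⟩ | ⟨a, b, h1, h2, h3, rfl⟩ | ⟨a, b, c, h1, h2, h3, h4, rfl⟩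
  · decide
  · interval_cases a <;> decide
  · omega
  · omega

theorem centralizedByInvolution_sym_five {x : Sym 5} (hx : x.cycleType ≠ {5}) :
    CentralizedByInvolution x := by
  refine centralizedByInvolution_of_cycleType_ne (by norm_num) (fun m h => ?_) hx
  rcases h with rfl | ⟨a, h1, h2, rfl⟩ | ⟨a, b, h1, h2, h3, rfl⟩ | ⟨a, b, c, h1, h2, h3, h4, rfl⟩
  · decide
  · interval_cases a <;> decide
  · have : a ≤ 3 := by omega
    have : b ≤ 3 := by omega
    interval_cases a <;> interval_cases b <;> first | omega | decide
  · omega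

theorem centralizedByInvolution_sym_six {x : Sym 6} (hx : x.cycleType ≠ {5}) :
    CentralizedByInvolution x := by
  refine centralizedByInvolution_of_cycleType_ne (by norm_num) (fun m h => ?_) hx
  rcases h with rfl | ⟨a, h1, h2, rfl⟩ | ⟨a, b, h1, h2, h3, rfl⟩ | ⟨a, b, c, h1, h2, h3, h4, rfl⟩
  · decide
  · interval_cases a <;> decide
  · have : a ≤ 4 := by omega
    have : b ≤ 4 := by omega
    interval_cases a <;> interval_cases b <;> first | omega | decide
  · obtain ⟨rfl, rfl, rfl⟩ : a = 2 ∧ b = 2 ∧ c = 2 := by omega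
    decide

theorem centralizedByInvolution_sym_seven {x : Sym 7} (hx : x.cycleType ≠ {7}) :
    CentralizedByInvolution x := by
  refine centralizedByInvolution_of_cycleType_ne le_rfl (fun m h => ?_) hx
  rcases h with rfl | ⟨a, h1, h2, rfl⟩ | ⟨a, b, h1, h2, h3, rfl⟩ | ⟨a, b, c, h1, h2, h3, h4, rfl⟩
  · decide
  · interval_cases a <;> decide
  · have : a ≤ 5 := by omega
    have : b ≤ 5 := by omega
    interval_cases a <;> interval_cases b <;> first | omega | decide
  · have : a ≤ 3 := by omega
    have : b ≤ 3 := by omega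
    have : c ≤ 3 := by omega
    interval_cases a <;> interval_cases b <;> interval_cases c <;> first | omega | decide

variable (k)

/-- z is a rotation of the pentagon and t the reflection fixing 0, which inverts it; `lt` and `ls`
list the values of the reflections t and zt. The other degrees follow the same pattern. -/
theorem defectZeroCount_sym_five : DefectZeroCount k (Sym 5) 0 := by
  refine defectZeroCount_sym_of_even (p := 5) (f := 0) (by norm_num) rfl (by decide)
    (fun x => centralizedByInvolution_sym_five) (z := c[0, 1, 2, 3, 4])
    (t := c[1, 4] * c[2, 3]) (lt := [0, 4, 3, 2, 1]) (ls := [1, 0, 4, 3, 2])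
    ?_ (by decide) (by decide) (by decide) (by decide) (by decide +kernel)
  decide +kernel

theorem defectZeroCount_sym_six : DefectZeroCount k (Sym 6) 1 := by
  refine defectZeroCount_sym_of_odd (p := 5) (f := 1) (by norm_num) rfl (by decide)
    (fun x => centralizedByInvolution_sym_six) (z := c[0, 1, 2, 3, 4])
    (t := c[1, 4] * c[2, 3]) (lt := [0, 4, 3, 2, 1, 5]) (ls := [1, 0, 4, 3, 2, 5])
    ?_ (by decide) (by decide) (by decide) (by decide) (by decide +kernel)
  decide +kernel

theorem defectZeroCount_sym_seven : DefectZeroCount k (Sym 7) 0 := by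
  refine defectZeroCount_sym_of_even (p := 7) (f := 0) (by norm_num) rfl (by decide)
    (fun x => centralizedByInvolution_sym_seven) (z := c[0, 1, 2, 3, 4, 5, 6])
    (t := c[1, 6] * c[2, 5] * c[3, 4]) (lt := [0, 6, 5, 4, 3, 2, 1])
    (ls := [1, 0, 6, 5, 4, 3, 2])
    ?_ (by decide) (by decide) (by decide) (by decide) (by decide +kernel)
  decide +kernel

theorem defectZeroCount_sym_three : DefectZeroCount k (Sym 3) 1 := by
  refine defectZeroCount_sym_of_odd (p := 3) (f := 0) (by norm_num) rfl (by decide)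
    (fun x => centralizedByInvolution_sym_three) (z := c[0, 1, 2])
    (t := c[1, 2]) (lt := [0, 2, 1]) (ls := [1, 0, 2])
    ?_ (by decide) (by decide) (by decide) (by decide) (by decide +kernel)
  decide +kernel

end Symmetric

/-! ### The alternating group of degree seven. -/

section Alternating

/-- The cycle types of the elements of the alternating group of degree seven that do not commute
with an even involution. -/
def oddCentralizerTypes : Fin 3 → Multiset ℕ := ![{7}, {5}, {3, 3}]

/-- The count depends only on the conjugacy class of h, so it is made at one representative of each
type, with an involution inverting it. -/
theorem even_structureConstant_seven {p j f : ℕ} (hp : p.Prime) (hn : 7 = j * p + f)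
    (h7 : Even ((permLists 7).countP fun l =>
      intertwines 7 [0, 6, 5, 4, 3, 2, 1] [1, 0, 6, 5, 4, 3, 2] l && hasType 7 p f l))
    (h5 : Even ((permLists 7).countP fun l =>
      intertwines 7 [0, 4, 3, 2, 1, 5, 6] [1, 0, 4, 3, 2, 5, 6] l && hasType 7 p f l))
    (h3 : Even ((permLists 7).countP fun l =>
      intertwines 7 [0, 2, 1, 3, 5, 4, 6] [1, 0, 2, 4, 3, 5, 6] l && hasType 7 p f l))
    (i : Fin 3) {h : Sym 7} (hh : h.cycleType = oddCentralizerTypes i) :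
    Even (Finset.card {x : Sym 7 | x.cycleType = Multiset.replicate j p ∧
      (x⁻¹ * h).cycleType = Multiset.replicate j p}) := by
  obtain ⟨z, hz, hE⟩ : ∃ z : Sym 7, z.cycleType = oddCentralizerTypes i ∧
      Even (Finset.card {x : Sym 7 | x.cycleType = Multiset.replicate j p ∧
        (x⁻¹ * z).cycleType = Multiset.replicate j p}) := by
    have hi : i = 0 ∨ i = 1 ∨ i = 2 := by omega
    rcases hi with rfl | rfl | rfl
    · exact ⟨c[0, 1, 2, 3, 4, 5, 6], by decide +kernel,
        (even_structureConstant_iff hp hn (t := c[1, 6] * c[2, 5] * c[3, 4]) (by decide)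
          (by decide) (by decide) (by decide)).2 h7⟩
    · exact ⟨c[0, 1, 2, 3, 4], by decide +kernel,
        (even_structureConstant_iff hp hn (t := c[1, 4] * c[2, 3]) (by decide)
          (by decide) (by decide) (by decide)).2 h5⟩
    · exact ⟨c[0, 1, 2] * c[3, 4, 5], by decide +kernel,
        (even_structureConstant_iff hp hn (t := c[1, 2] * c[4, 5]) (by decide)
          (by decide) (by decide) (by decide)).2 h3⟩
  have hc : IsConj z h := Equiv.Perm.isConj_iff_cycleType_eq.2 (hz.trans hh.symm)
  obtain ⟨c, rfl⟩ := isConj_iff.1 hc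
  convert hE using 1
  refine Finset.card_bij' (fun x _ => c⁻¹ * x * c) (fun x _ => c * x * c⁻¹) ?_ ?_ ?_ ?_
  · intro x hx
    simp only [Finset.mem_filter, Finset.mem_univ, true_and] at hx ⊢
    rw [← Equiv.Perm.cycleType_conj (σ := c⁻¹ * x * c) (τ := c),
      ← Equiv.Perm.cycleType_conj (σ := (c⁻¹ * x * c)⁻¹ * z) (τ := c),
      show c * (c⁻¹ * x * c) * c⁻¹ = x by group,
      show c * ((c⁻¹ * x * c)⁻¹ * z) * c⁻¹ = x⁻¹ * (c * z * c⁻¹) by group]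
    exact hx
  · intro x hx
    simp only [Finset.mem_filter, Finset.mem_univ, true_and] at hx ⊢
    rw [Equiv.Perm.cycleType_conj,
      show (c * x * c⁻¹)⁻¹ * (c * z * c⁻¹) = c * (x⁻¹ * z) * c⁻¹ by group,
      Equiv.Perm.cycleType_conj]
    exact hx
  · intro x _; group
  · intro x _; group

set_option maxHeartbeats 2000000 in
theorem even_structureConstant_oddCentralizerTypes (i j : Fin 3) {h : Sym 7}
    (hh : h.cycleType = oddCentralizerTypes j) :
    Even (Finset.card {x : Sym 7 | x.cycleType = oddCentralizerTypes i ∧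
      (x⁻¹ * h).cycleType = oddCentralizerTypes i}) := by
  have h0 : oddCentralizerTypes 0 = Multiset.replicate 1 7 := by decide
  have h1 : oddCentralizerTypes 1 = Multiset.replicate 1 5 := by decide
  have h2 : oddCentralizerTypes 2 = Multiset.replicate 2 3 := by decide
  have hi : i = 0 ∨ i = 1 ∨ i = 2 := by omega
  rcases hi with rfl | rfl | rfl
  · rw [h0]
    exact even_structureConstant_seven (f := 0) (by norm_num) rfl
      (by decide +kernel) (by decide +kernel) (by decide +kernel) j hh
  · rw [h1]
    exact even_structureConstant_seven (f := 2) (by norm_num) rfl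
      (by decide +kernel) (by decide +kernel) (by decide +kernel) j hh
  · rw [h2]
    exact even_structureConstant_seven (f := 1) (by norm_num) rfl
      (by decide +kernel) (by decide +kernel) (by decide +kernel) j hh

/-- The centralizer in S₇ has order divisible by 4, and its intersection with A₇ has index at most 2
in it, hence even order. -/
theorem centralizedByInvolution_alternating (x : alternatingGroup (Fin 7))
    (hx : ∀ i, (x : Sym 7).cycleType ≠ oddCentralizerTypes i) : CentralizedByInvolution x := by
  have h4 : 4 ∣ centralizerCard 7 (x : Sym 7).cycleType := by
    have h7 := hx 0
    have h5 := hx 1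
    have h33 := hx 2
    have hsign := Equiv.Perm.sign_of_cycleType (x : Sym 7)
    rw [Equiv.Perm.mem_alternatingGroup.1 x.2] at hsign
    rcases cycleType_cases le_rfl (x : Sym 7) with h | ⟨a, h1, h2, h⟩ | ⟨a, b, h1, h2, h3, h⟩ |
      ⟨a, b, c, h1, h2, h3, h4, h⟩ <;> rw [h] at h7 h5 h33 hsign ⊢
    · decide
    · clear h hx
      interval_cases a <;> first | decide | exact absurd rfl h7 | exact absurd rfl h5 |
        exact absurd hsign (by decide)
    · clear h hx
      have : a ≤ 5 := by omega
      have : b ≤ 5 := by omega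
      interval_cases a <;> interval_cases b <;> first | omega | decide | exact absurd rfl h33 |
        exact absurd hsign (by decide)
    · clear h hx
      have : a ≤ 3 := by omega
      have : b ≤ 3 := by omega
      have : c ≤ 3 := by omega
      interval_cases a <;> interval_cases b <;> interval_cases c <;> first | omega | decide
  let C := Subgroup.centralizer {(x : Sym 7)}
  have hK : 2 ∣ Nat.card (alternatingGroup (Fin 7) ⊓ C : Subgroup (Sym 7)) := by
    have h1 := Subgroup.relIndex_dvd_index_of_normal (alternatingGroup (Fin 7)) C
    have h2 : (alternatingGroup (Fin 7)).index = 2 := alternatingGroup.index_eq_two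
    have h3 : Nat.card (alternatingGroup (Fin 7) ⊓ C : Subgroup (Sym 7)) *
        (alternatingGroup (Fin 7)).relIndex C = Nat.card C := by
      rw [← Subgroup.inf_relIndex_right, ← Subgroup.relIndex_bot_left,
        Subgroup.relIndex_mul_relIndex _ _ _ bot_le inf_le_right, Subgroup.relIndex_bot_left]
    rw [card_centralizer_eq] at h3
    rw [h2] at h1
    rw [← h3] at h4
    have := h4.trans (Nat.mul_dvd_mul_left _ h1)
    omega
  obtain ⟨t, ht, ht1, ht2⟩ := exists_involution_of_even_card hK
  exact ⟨⟨t, ht.1⟩, fun h => ht1 (congrArg Subtype.val h), Subtype.ext ht2,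
    Subtype.ext (Subgroup.mem_centralizer_singleton_iff.1 ht.2)⟩

variable {k : Type*} [Field k]

/-- The automorphism of the group algebra of the alternating group given by conjugation with a
permutation. -/
noncomputable def conjAlternating (k : Type*) [Field k] (τ : Sym 7) :
    k[alternatingGroup (Fin 7)] ≃ₐ[k] k[alternatingGroup (Fin 7)] :=
  MonoidAlgebra.domCongr k k (MulAut.conjNormal τ)

theorem coeff_conjAlternating (τ : Sym 7) (x : k[alternatingGroup (Fin 7)])
    (a : alternatingGroup (Fin 7)) :
    (conjAlternating k τ x).coeff (MulAut.conjNormal τ a) = x.coeff a := by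
  rw [conjAlternating, coeff_domCongr, MulEquiv.symm_apply_apply]

theorem conjAlternating_mem_projCenter (τ : Sym 7) {x : k[alternatingGroup (Fin 7)]}
    (hx : x ∈ projCenter k (alternatingGroup (Fin 7))) :
    conjAlternating k τ x ∈ projCenter k (alternatingGroup (Fin 7)) := by
  obtain ⟨a, rfl⟩ := hx
  refine ⟨conjAlternating k τ a, ?_⟩
  rw [trace_apply, trace_apply, map_sum]
  refine (Fintype.sum_equiv (MulAut.conjNormal τ).toEquiv _ _ fun g => ?_).symm
  simp [conjAlternating]

variable [CharP k 2]

/-- Idempotents of the projective centre invariant under all permutations vanish. -/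
theorem eq_zero_of_idempotent_alternating {e : k[alternatingGroup (Fin 7)]}
    (he : e ∈ projCenter k (alternatingGroup (Fin 7)))
    (hinv : ∀ x y : alternatingGroup (Fin 7), IsConj (x : Sym 7) y → e.coeff x = e.coeff y)
    (hee : e * e = e) : e = 0 := by
  classical
  let S : Fin 3 → Finset (alternatingGroup (Fin 7)) := fun i =>
    Finset.univ.filter fun x => (x : Sym 7).cycleType = oddCentralizerTypes i
  have hdisj : ∀ i j, i ≠ j → oddCentralizerTypes i ≠ oddCentralizerTypes j := by decide
  obtain ⟨α, hα⟩ : ∃ α : Fin 3 → k, ∀ i, ∀ x : alternatingGroup (Fin 7),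
      (x : Sym 7).cycleType = oddCentralizerTypes i → e.coeff x = α i := by
    refine ⟨fun i => if h : ∃ x : alternatingGroup (Fin 7),
      (x : Sym 7).cycleType = oddCentralizerTypes i then e.coeff h.choose else 0, fun i x hx => ?_⟩
    have h : ∃ x : alternatingGroup (Fin 7),
      (x : Sym 7).cycleType = oddCentralizerTypes i := ⟨x, hx⟩
    beta_reduce
    rw [dif_pos h]
    exact hinv _ _ (Equiv.Perm.isConj_iff_cycleType_eq.2 (hx.trans h.choose_spec.symm))
  have hsum : e = ∑ i, α i • setSum k (S i) := by
    ext x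
    rw [coeff_sum, Finsupp.finsetSum_apply]
    simp only [coeff_smul_apply, coeff_setSum, S, Finset.mem_filter, Finset.mem_univ, true_and]
    by_cases hx : ∃ i, (x : Sym 7).cycleType = oddCentralizerTypes i
    · obtain ⟨i, hi⟩ := hx
      rw [Finset.sum_eq_single i]
      · rw [if_pos hi, hα i x hi, smul_eq_mul, mul_one]
      · intro j _ hj
        rw [if_neg fun h => hdisj i j hj.symm (hi.symm.trans h), smul_zero]
      · simp
    · push Not at hx
      rw [coeff_eq_zero_of_centralized he (centralizedByInvolution_alternating x hx)]
      refine (Finset.sum_eq_zero fun i _ => ?_).symm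
      rw [if_neg (hx i), smul_zero]
  have hcent : ∀ i, setSum k (S i) ∈ Subalgebra.center k k[alternatingGroup (Fin 7)] := fun i => by
    refine setSum_mem_center _ fun g x hx => ?_
    simp only [S, Finset.mem_filter, Finset.mem_univ, true_and] at hx ⊢
    simpa [Equiv.Perm.cycleType_conj] using hx
  have hsq : ∀ i (x : alternatingGroup (Fin 7)), (∃ j, (x : Sym 7).cycleType =
      oddCentralizerTypes j) → (setSum k (S i) * setSum k (S i)).coeff x = 0 := by
    rintro i x ⟨j, hj⟩
    rw [coeff_setSum_mul_setSum]
    -- All permutations of the three types are even, so the count in A₇ is the one in S₇.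
    have hcard : Finset.card {y ∈ S i | y⁻¹ * x ∈ S i} =
        Finset.card {y : Sym 7 | y.cycleType = oddCentralizerTypes i ∧
          (y⁻¹ * x).cycleType = oddCentralizerTypes i} := by
      refine Finset.card_bij (fun y _ => (y : Sym 7)) ?_ (fun _ _ _ _ h => Subtype.ext h) ?_
      · intro y hy
        simpa [S] using hy
      · intro y hy
        simp only [Finset.mem_filter, Finset.mem_univ, true_and] at hy
        refine ⟨⟨y, ?_⟩, by simpa [S] using hy, rfl⟩
        rw [Equiv.Perm.mem_alternatingGroup, Equiv.Perm.sign_of_cycleType, hy.1]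
        fin_cases i <;> decide
    rw [hcard]
    obtain ⟨n, hn⟩ := even_structureConstant_oddCentralizerTypes i j hj
    rw [hn, Nat.cast_add, CharTwo.add_self_eq_zero]
  -- Squaring is additive on commuting elements in characteristic two, so mixed products of class
  -- sums are not needed.
  have hexp : e * e = ∑ i, (α i * α i) • (setSum k (S i) * setSum k (S i)) := by
    have h2 : ∀ x : k[alternatingGroup (Fin 7)], x + x = 0 := fun x => by
      rw [← two_smul k, CharTwo.two_eq_zero, zero_smul]
    have hcomm : ∀ i j, setSum k (S i) * setSum k (S j) = setSum k (S j) * setSum k (S i) :=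
      fun i j => Subalgebra.mem_center_iff.1 (hcent j) _
    rw [hsum]
    simp only [Fin.sum_univ_three, add_mul, mul_add, smul_mul_smul_comm]
    rw [hcomm 1 0, hcomm 2 0, hcomm 2 1, mul_comm (α 1) (α 0), mul_comm (α 2) (α 0),
      mul_comm (α 2) (α 1)]
    generalize (α 0 * α 1) • (setSum k (S 0) * setSum k (S 1)) = A
    generalize (α 0 * α 2) • (setSum k (S 0) * setSum k (S 2)) = B
    generalize (α 1 * α 2) • (setSum k (S 1) * setSum k (S 2)) = C
    generalize (α 0 * α 0) • (setSum k (S 0) * setSum k (S 0)) = X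
    generalize (α 1 * α 1) • (setSum k (S 1) * setSum k (S 1)) = Y
    generalize (α 2 * α 2) • (setSum k (S 2) * setSum k (S 2)) = Z
    calc X + A + B + (A + Y + C) + (B + C + Z) = X + Y + Z + (A + A) + (B + B) + (C + C) := by abel
      _ = X + Y + Z := by rw [h2, h2, h2]; simp
  ext x
  by_cases hx : ∃ i, (x : Sym 7).cycleType = oddCentralizerTypes i
  · rw [← hee, hexp, coeff_sum, Finsupp.finsetSum_apply]
    refine Finset.sum_eq_zero fun i _ => ?_
    rw [coeff_smul_apply, hsq i x hx, smul_zero]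
  · push Not at hx
    exact coeff_eq_zero_of_centralized he (centralizedByInvolution_alternating x hx)

variable (k) [IsAlgClosed k]

theorem defectZeroCount_alternating_seven :
    DefectZeroCount k (alternatingGroup (Fin 7)) 0 := by
  refine defectZeroCount_zero fun b hb hbb => ?_
  let τ : Sym 7 := Equiv.swap 0 1
  have hτ : τ * τ = 1 := Equiv.swap_mul_self 0 1
  let F := conjAlternating k τ
  have hFF : ∀ x, F (F x) = x := fun x => by
    ext a
    have ha : MulAut.conjNormal τ (MulAut.conjNormal τ a) = a := by
      rw [← MulAut.mul_apply, ← map_mul, hτ, map_one, MulAut.one_apply]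
    conv_lhs => rw [← ha]
    rw [coeff_conjAlternating, coeff_conjAlternating]
  have hFb : F b ∈ projCenter k (alternatingGroup (Fin 7)) := conjAlternating_mem_projCenter τ hb
  have hbc := projCenter_le_center hb
  have hcomm : F b * b = b * F b := Subalgebra.mem_center_iff.1 hbc _
  have hFbb : F b * F b = F b := by rw [← map_mul, hbb]
  have h2 : ∀ x : k[alternatingGroup (Fin 7)], x + x = 0 := fun x => by
    rw [← two_smul k, CharTwo.two_eq_zero, zero_smul]
  -- In characteristic two this is the join b + F b − b·F b of two commuting idempotents. It is
  -- fixed by F, and be = b, so it suffices to show that it vanishes.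
  set e := b + F b + b * F b with he
  have hep : e ∈ projCenter k (alternatingGroup (Fin 7)) :=
    add_mem (add_mem hb hFb) (mul_mem_projCenter hFb hbc)
  have hbe : b * e = b := by
    rw [he, mul_add, mul_add, ← mul_assoc, hbb, add_assoc, h2, add_zero]
  have hFbe : F b * e = F b := by
    rw [he, mul_add, mul_add, ← mul_assoc, hcomm, mul_assoc, hFbb, add_right_comm, h2, zero_add]
  have hee : e * e = e := by
    conv_lhs => rw [he, add_mul, add_mul, mul_assoc, hFbe, hbe]
  have hFe : F e = e := by
    rw [he, map_add, map_add, map_mul, hFF, hcomm, add_comm (F b) b]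
  have hec := projCenter_le_center hep
  have hinv : ∀ x y : alternatingGroup (Fin 7), IsConj (x : Sym 7) y →
      e.coeff x = e.coeff y := by
    intro x y hxy
    obtain ⟨c, hc⟩ := isConj_iff.1 hxy
    rcases Int.units_eq_one_or (Equiv.Perm.sign c) with h1 | h1
    · rw [← coeff_conj_of_mem_center hec ⟨c, Equiv.Perm.mem_alternatingGroup.2 h1⟩ x]
      exact congrArg _ (Subtype.ext hc)
    -- For odd c, conjugate by the even permutation τc and undo τ by the F-invariance of e.
    · have hτc : τ * c ∈ alternatingGroup (Fin 7) := by
        rw [Equiv.Perm.mem_alternatingGroup, map_mul, h1, Equiv.Perm.sign_swap (by decide)]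
        rfl
      rw [← coeff_conj_of_mem_center hec ⟨τ * c, hτc⟩ x, ← coeff_conjAlternating τ]
      change (F e).coeff _ = _
      rw [hFe]
      refine congrArg _ (Subtype.ext ?_)
      rw [MulAut.conjNormal_apply]
      change τ * (τ * c * x * (τ * c)⁻¹) * τ⁻¹ = y
      rw [← hc, show τ * (τ * c * x * (τ * c)⁻¹) * τ⁻¹ =
        (τ * τ) * (c * x * c⁻¹) * (τ * τ)⁻¹ by group, hτ]
      simp
  rw [← hbe, eq_zero_of_idempotent_alternating hep hinv hee, mul_zero]

end Alternating

/-! ### Direct products. -/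

section Products

variable {k : Type*} [Field k] [IsAlgClosed k] [CharP k 2]

/-- `S` is the only conjugacy class of `G` whose elements have centralizers of odd order, and its
structure constant is odd. -/
structure IsOddClass {G : Type*} [Group G] [DecidableEq G] (S : Finset G) : Prop where
  conj : ∀ x ∈ S, ∀ y ∈ S, IsConj x y
  stable : ∀ g, ∀ x ∈ S, g * x * g⁻¹ ∈ S
  odd : ∀ x ∈ S, ¬ CentralizedByInvolution x
  compl : ∀ x ∉ S, CentralizedByInvolution x
  card : ∃ x₀ ∈ S, Odd {x ∈ S | x⁻¹ * x₀ ∈ S}.card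

theorem IsOddClass.defectZeroCount {G : Type} [Group G] [Finite G] [DecidableEq G] {S : Finset G}
    (h : IsOddClass S) : DefectZeroCount k G 1 := by
  have := Fintype.ofFinite G
  obtain ⟨x₀, hx₀, hodd⟩ := h.card
  exact defectZeroCount_one_of_odd S h.conj h.stable h.odd h.compl hx₀ hodd

/-- Centralizers in a direct product are products of centralizers, and structure constants multiply.
-/
theorem IsOddClass.prod {G H : Type*} [Group G] [DecidableEq G] [Group H] [DecidableEq H]
    {S : Finset G} {T : Finset H} (hS : IsOddClass S) (hT : IsOddClass T) :
    IsOddClass (S ×ˢ T) where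
  conj := by
    rintro ⟨x, y⟩ h ⟨x', y'⟩ h'
    rw [Finset.mem_product] at h h'
    obtain ⟨c, hc⟩ := isConj_iff.1 (hS.conj _ h.1 _ h'.1)
    obtain ⟨d, hd⟩ := isConj_iff.1 (hT.conj _ h.2 _ h'.2)
    exact isConj_iff.2 ⟨(c, d), Prod.ext hc hd⟩
  stable := by
    rintro ⟨g, g'⟩ ⟨x, y⟩ h
    rw [Finset.mem_product] at h
    exact Finset.mem_product.2 ⟨hS.stable _ _ h.1, hT.stable _ _ h.2⟩
  odd := by
    rintro ⟨x, y⟩ h ⟨⟨t, u⟩, h1, h2, h3⟩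
    rw [Finset.mem_product] at h
    rw [Prod.ext_iff] at h2 h3
    by_cases ht : t = 1
    · refine hT.odd _ h.2 ⟨u, fun hu => h1 (Prod.ext ht hu), h2.2, h3.2⟩
    · exact hS.odd _ h.1 ⟨t, ht, h2.1, h3.1⟩
  compl := by
    rintro ⟨x, y⟩ h
    rw [Finset.mem_product, not_and_or] at h
    rcases h with h | h
    · obtain ⟨t, h1, h2, h3⟩ := hS.compl _ h
      exact ⟨(t, 1), fun e => h1 (congrArg Prod.fst e), Prod.ext h2 (one_mul 1),
        Prod.ext h3 ((one_mul _).trans (mul_one _).symm)⟩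
    · obtain ⟨t, h1, h2, h3⟩ := hT.compl _ h
      exact ⟨(1, t), fun e => h1 (congrArg Prod.snd e), Prod.ext (one_mul 1) h2,
        Prod.ext ((one_mul _).trans (mul_one _).symm) h3⟩
  card := by
    obtain ⟨x, hx, hxo⟩ := hS.card
    obtain ⟨y, hy, hyo⟩ := hT.card
    refine ⟨(x, y), Finset.mk_mem_product hx hy, ?_⟩
    have : {z ∈ S ×ˢ T | z⁻¹ * (x, y) ∈ S ×ˢ T} =
        {z ∈ S | z⁻¹ * x ∈ S} ×ˢ {z ∈ T | z⁻¹ * y ∈ T} := by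
      ext ⟨a, b⟩
      simp only [Finset.mem_filter, Finset.mem_product, Prod.mk_mul_mk, Prod.inv_mk]
      tauto
    rw [this, Finset.card_product]
    exact hxo.mul hyo

theorem isOddClass_sym_three : IsOddClass ({x : Sym 3 | x * x * x = 1 ∧ x ≠ 1} : Finset _) where
  conj := by
    simp only [isConj_iff]
    decide +kernel
  stable := by decide +kernel
  odd := by
    unfold CentralizedByInvolution
    decide +kernel
  compl := by
    unfold CentralizedByInvolution
    decide +kernel
  card := by decide +kernel

end Products

/-! ### Semidirect products and elements of order nine. -/

section SemidirectProducts

instance SemidirectProduct.fintype {N G : Type*} [Group N] [Group G] [Fintype N] [Fintype G]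
    (φ : G →* MulAut N) : Fintype (N ⋊[φ] G) :=
  Fintype.ofEquiv _ SemidirectProduct.equivProd.symm

/-- Decidable equality of semidirect products, in a form that reduces in the kernel. -/
instance (priority := 2000) SemidirectProduct.decEq {N G : Type*} [Group N] [Group G]
    [DecidableEq N] [DecidableEq G] (φ : G →* MulAut N) : DecidableEq (N ⋊[φ] G) :=
  fun _ _ => decidable_of_iff _ SemidirectProduct.ext_iff.symm

instance : Fintype C3SqInv := SemidirectProduct.fintype _

instance : Fintype C3CubeInvPerm := SemidirectProduct.fintype _

theorem two_dvd_orderOf {G : Type*} [Group G] {y : G} {m : ℕ} (h1 : y ^ (2 * m) = 1)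
    (h2 : y ^ m ≠ 1) : 2 ∣ orderOf y := by
  by_contra h
  refine h2 (orderOf_dvd_iff_pow_eq_one.1 ?_)
  exact (Nat.Coprime.symm ((Nat.Prime.coprime_iff_not_dvd Nat.prime_two).2 h)).dvd_of_dvd_mul_left
    (orderOf_dvd_of_pow_eq_one h1)

/-- Elements with an image of even order commute with an involution. -/
theorem centralizedByInvolution_of_map {G H : Type*} [Group G] [Finite G] [Group H] (φ : G →* H)
    {x : G} {m : ℕ} (h1 : φ x ^ (2 * m) = 1) (h2 : φ x ^ m ≠ 1) : CentralizedByInvolution x :=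
  centralizedByInvolution_of_even_orderOf ((two_dvd_orderOf h1 h2).trans (orderOf_map_dvd φ x))

theorem CentralizedByInvolution.of_inv {G : Type*} [Group G] {x : G}
    (h : CentralizedByInvolution x⁻¹) : CentralizedByInvolution x := by
  obtain ⟨t, h1, h2, h3⟩ := h
  exact ⟨t, h1, h2, (Commute.inv_right_iff.1 (show Commute t x⁻¹ from h3)).eq⟩

/-- The elements of order nine form the class required in `IsOddClass`, under conditions on a
representative `x₀` and an involution `t` inverting it. -/
theorem isOddClass_of_order_nine {G : Type*} [Group G] [Fintype G] [DecidableEq G] {x₀ t : G}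
    (hx₀ : x₀ ^ 9 = 1 ∧ x₀ ^ 3 ≠ 1)
    (hconj : ∀ x : G, x ^ 9 = 1 ∧ x ^ 3 ≠ 1 → IsConj x x₀)
    (hodd : ¬ ∃ s, s * x₀ = x₀ * s ∧ s ≠ 1 ∧ s * s = 1)
    (hcompl : ∀ x : G, ¬ (x ^ 9 = 1 ∧ x ^ 3 ≠ 1) → CentralizedByInvolution x)
    (ht : t * t = 1) (htx : t * x₀ * t = x₀⁻¹)
    (hcard : ¬ Even (Finset.card {x : G | x * t = x₀ * t * x ∧ x ^ 9 = 1 ∧ x ^ 3 ≠ 1})) :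
    IsOddClass ({x : G | x ^ 9 = 1 ∧ x ^ 3 ≠ 1} : Finset G) where
  conj x hx y hy := by
    rw [Finset.mem_filter_univ] at hx hy
    exact (hconj x hx).trans (hconj y hy).symm
  stable g x hx := by
    rw [Finset.mem_filter_univ] at hx ⊢
    simpa [conj_pow] using hx
  odd x hx h := by
    rw [Finset.mem_filter_univ] at hx
    obtain ⟨s, h1, h2, h3⟩ := h.of_isConj (hconj x hx)
    exact hodd ⟨s, h3, h1, h2⟩
  compl x hx := by
    rw [Finset.mem_filter_univ] at hx
    exact hcompl x hx
  card := by
    refine ⟨x₀, by rw [Finset.mem_filter_univ]; exact hx₀, ?_⟩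
    rw [← Nat.not_even_iff_odd, Finset.filter_filter]
    simp only [Finset.mem_filter_univ]
    rwa [card_modEq_card_intertwining (fun x : G => x ^ 9 = 1 ∧ x ^ 3 ≠ 1) (fun g x h => by
      simpa [conj_pow] using h) (fun x h => by simpa [inv_pow] using h) ht htx]

end SemidirectProducts

/-! ### The group (C₃)³ ⋊ (C₂ × S₃). -/

section InversionPerm

set_option synthInstance.maxSize 1000 in
set_option synthInstance.maxHeartbeats 200000 in
theorem isOddClass_C3CubeInvPerm :
    IsOddClass ({x : C3CubeInvPerm | x ^ 9 = 1 ∧ x ^ 3 ≠ 1} : Finset _) := by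
  have hright : ∀ p : ℤˣ × Sym 3, p ^ (2 * 3) = 1 := by decide +kernel
  have hcube : ∀ p : ℤˣ × Sym 3, p ^ 3 = 1 → p = 1 ∨
      (p.1 = 1 ∧ p.2 * p.2 * p.2 = 1 ∧ p.2 ≠ 1) := by decide +kernel
  -- Elements are sorted by their image in C₂ × S₃. If its cube is nontrivial, the order is even.
  -- Over 1 an involution of the complement fixes v; over a rotation the element has order nine or
  -- commutes with an involution over (−1, 1).
  have hbase : ∀ v : Fin 3 → C3, ∃ p : ℤˣ × Sym 3,
      p ≠ 1 ∧ p * p = 1 ∧ inversionPermAction p v = v := by decide +kernel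
  have hrot : ∀ v : Fin 3 → C3, ∀ σ : Sym 3, σ * σ * σ = 1 → σ ≠ 1 →
      ((⟨v, (1, σ)⟩ : C3CubeInvPerm) ^ 9 = 1 ∧ (⟨v, (1, σ)⟩ : C3CubeInvPerm) ^ 3 ≠ 1) ∨
        ∃ w : Fin 3 → C3,
          (⟨w, (-1, 1)⟩ : C3CubeInvPerm) * ⟨v, (1, σ)⟩ = ⟨v, (1, σ)⟩ * ⟨w, (-1, 1)⟩ := by
    decide +kernel
  have hinv : ∀ w : Fin 3 → C3, (⟨w, (-1, 1)⟩ : C3CubeInvPerm) ≠ 1 ∧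
      (⟨w, (-1, 1)⟩ : C3CubeInvPerm) * ⟨w, (-1, 1)⟩ = 1 := by decide +kernel
  have hconj : ∀ v : Fin 3 → C3, ∀ σ : Sym 3, σ * σ * σ = 1 → σ ≠ 1 →
      (⟨v, (1, σ)⟩ : C3CubeInvPerm) ^ 3 = 1 ∨ ∃ c : C3CubeInvPerm,
        c * ⟨v, (1, σ)⟩ = ⟨Pi.mulSingle 0 (Multiplicative.ofAdd 1), (1, finRotate 3)⟩ * c := by
    decide +kernel
  have hleft : ∀ v : Fin 3 → C3, (⟨v, 1⟩ : C3CubeInvPerm) ^ 3 = 1 := by decide +kernel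
  refine isOddClass_of_order_nine
    (x₀ := ⟨Pi.mulSingle 0 (Multiplicative.ofAdd 1), (1, finRotate 3)⟩)
    (t := ⟨1, (-1, Equiv.swap 0 2)⟩) (by decide +kernel) ?_ (by decide +kernel) ?_
    (by decide +kernel) (by decide +kernel) (by decide +kernel)
  · rintro ⟨v, p⟩ ⟨h9, h3⟩
    have hp9 : p ^ 9 = 1 := by
      have := congrArg SemidirectProduct.rightHom h9
      rwa [map_pow, map_one] at this
    have hp3 : p ^ 3 = 1 := by
      rw [show 9 = 2 * 3 + 3 from rfl, pow_add, hright, one_mul] at hp9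
      exact hp9
    rcases hcube p hp3 with rfl | ⟨h1, h2, h4⟩
    · exact absurd (hleft v) h3
    · obtain ⟨u, σ⟩ := p
      obtain rfl : u = 1 := h1
      obtain ⟨c, hc⟩ := (hconj v σ h2 h4).resolve_left h3
      exact isConj_iff.2 ⟨c, mul_inv_eq_of_eq_mul hc⟩
  · rintro ⟨v, p⟩ hQ
    by_cases hp3 : p ^ 3 = 1
    · rcases hcube p hp3 with rfl | ⟨h1, h2, h4⟩
      · obtain ⟨q, h1, h2, h3⟩ := hbase v
        refine ⟨⟨1, q⟩, fun h => h1 (congrArg SemidirectProduct.right h), ?_, ?_⟩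
        · ext1 <;> simp [h2]
        · ext1 <;> simp [h3]
      · obtain ⟨u, σ⟩ := p
        obtain rfl : u = 1 := h1
        obtain ⟨w, hw⟩ := (hrot v σ h2 h4).resolve_left hQ
        exact ⟨_, (hinv w).1, (hinv w).2, hw⟩
    · exact centralizedByInvolution_of_map SemidirectProduct.rightHom (m := 3) (hright p) hp3

end InversionPerm

/-! ### Wreath products. -/

section Wreath

variable {H : Type} [Group H] {n : ℕ}

theorem wr_mul_left (x y : Wr H n) (i : Fin n) :
    (x * y).left i = x.left i * y.left (x.right⁻¹ i) := rfl

theorem centralizedByInvolution_base_of_centralized {f : Fin n → H} {i : Fin n}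
    (h : CentralizedByInvolution (f i)) : CentralizedByInvolution (⟨f, 1⟩ : Wr H n) := by
  obtain ⟨s, h1, h2, h3⟩ := h
  have hl : ∀ u v : Fin n → H, (⟨u, 1⟩ * ⟨v, 1⟩ : Wr H n) = ⟨u * v, 1⟩ := fun u v => rfl
  refine ⟨⟨Pi.mulSingle i s, 1⟩, fun h => h1 ?_, ?_, ?_⟩
  · simpa using congrFun (congrArg SemidirectProduct.left h) i
  · rw [hl, ← Pi.mulSingle_mul, h2, Pi.mulSingle_one]
    rfl
  · rw [hl, hl]
    congr 1
    ext1 a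
    rcases eq_or_ne a i with rfl | ha
    · simpa using h3
    · simp [ha]

/-- The involution swaps the coordinates i and j, twisted by c and c⁻¹. -/
theorem centralizedByInvolution_base_of_conj {f : Fin n → H} {i j : Fin n} (hij : i ≠ j) {c : H}
    (h : c * f i = f j * c) : CentralizedByInvolution (⟨f, 1⟩ : Wr H n) := by
  have h' : c⁻¹ * f j = f i * c⁻¹ := by
    rw [inv_mul_eq_iff_eq_mul, ← mul_assoc, h, mul_inv_cancel_right]
  refine ⟨⟨fun a => if a = j then c else if a = i then c⁻¹ else 1, Equiv.swap i j⟩,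
    fun h => hij ?_, ?_, ?_⟩
  · exact Equiv.swap_eq_one_iff.1 (congrArg SemidirectProduct.right h)
  · refine SemidirectProduct.ext (funext fun a => ?_) (Equiv.swap_mul_self i j)
    rw [wr_mul_left]
    rcases eq_or_ne a j with rfl | haj
    · simp [hij]
    rcases eq_or_ne a i with rfl | hai
    · simp [hij]
    · simp [haj, hai, Equiv.swap_apply_of_ne_of_ne]
  · refine SemidirectProduct.ext (funext fun a => ?_) ((mul_one _).trans (one_mul _).symm)
    rw [wr_mul_left, wr_mul_left]
    rcases eq_or_ne a j with rfl | haj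
    · simpa using h
    rcases eq_or_ne a i with rfl | hai
    · simpa [hij] using h'
    · simp [haj, hai, Equiv.swap_apply_of_ne_of_ne]

theorem centralizedByInvolution_or_conj (a b : Sym 3) :
    CentralizedByInvolution a ∨ CentralizedByInvolution b ∨ ∃ c, c * a = b * c := by
  unfold CentralizedByInvolution
  revert a b
  decide +kernel

/-- Only the 3-cycles of S₃ have odd centralizers, and they are conjugate. So either some coordinate
commutes with an involution or two coordinates can be swapped. -/
theorem centralizedByInvolution_base (f : Fin (n + 2) → Sym 3) :
    CentralizedByInvolution (⟨f, 1⟩ : Wr (Sym 3) (n + 2)) := by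
  rcases centralizedByInvolution_or_conj (f 0) (f 1) with h | h | ⟨c, hc⟩
  · exact centralizedByInvolution_base_of_centralized h
  · exact centralizedByInvolution_base_of_centralized h
  · exact centralizedByInvolution_base_of_conj (by simp) hc

theorem defectZeroCount_wr_two (k : Type*) [Field k] [IsAlgClosed k] [CharP k 2] :
    DefectZeroCount k (Wr (Sym 3) 2) 0 := by
  refine defectZeroCount_zero fun z hz _ => ?_
  ext x
  refine coeff_eq_zero_of_centralized hz ?_
  obtain ⟨f, σ⟩ := x
  have hσ : ∀ σ : Sym 2, σ = 1 ∨ σ ^ (2 * 1) = 1 ∧ σ ^ 1 ≠ 1 := by decide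
  rcases hσ σ with rfl | ⟨h1, h2⟩
  · exact centralizedByInvolution_base f
  · exact centralizedByInvolution_of_map SemidirectProduct.rightHom (m := 1) h1 h2

theorem wr_cube (f : Fin 3 → H) : (⟨f, finRotate 3⟩ : Wr H 3) ^ 3 =
    ⟨![f 0 * f 2 * f 1, f 1 * f 0 * f 2, f 2 * f 1 * f 0], 1⟩ := by
  rw [pow_succ, pow_two]
  refine SemidirectProduct.ext (funext fun a => ?_) ?_
  · simp only [wr_mul_left]
    fin_cases a <;> rfl
  · show finRotate 3 * finRotate 3 * finRotate 3 = 1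
    decide

/-- An involution s commuting with the cycle product at coordinate 0 is carried around the 3-cycle
by conjugation, giving one in the base group. -/
theorem centralizedByInvolution_rotate {f : Fin 3 → H}
    (h : CentralizedByInvolution (f 0 * f 2 * f 1)) :
    CentralizedByInvolution (⟨f, finRotate 3⟩ : Wr H 3) := by
  obtain ⟨s, h1, h2, h3⟩ := h
  have hs (u : H) : s * (s * u) = u := by rw [← mul_assoc, h2, one_mul]
  refine ⟨⟨![s, f 1 * s * (f 1)⁻¹, f 2 * f 1 * s * (f 1)⁻¹ * (f 2)⁻¹], 1⟩, fun h => h1 ?_, ?_, ?_⟩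
  · exact congrFun (congrArg SemidirectProduct.left h) 0
  · refine SemidirectProduct.ext (funext fun a => ?_) (mul_one 1)
    rw [wr_mul_left]
    fin_cases a
    · exact h2
    · show f 1 * s * (f 1)⁻¹ * (f 1 * s * (f 1)⁻¹) = 1
      simp [mul_assoc, hs]
    · show f 2 * f 1 * s * (f 1)⁻¹ * (f 2)⁻¹ * (f 2 * f 1 * s * (f 1)⁻¹ * (f 2)⁻¹) = 1
      simp [mul_assoc, hs]
  · refine SemidirectProduct.ext (funext fun a => ?_) ((one_mul _).trans (mul_one _).symm)
    rw [wr_mul_left, wr_mul_left]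
    fin_cases a
    · show s * f 0 = f 0 * (f 2 * f 1 * s * (f 1)⁻¹ * (f 2)⁻¹)
      rw [← mul_assoc, eq_mul_inv_iff_mul_eq, ← mul_assoc, eq_mul_inv_iff_mul_eq]
      simpa [mul_assoc] using h3
    · show f 1 * s * (f 1)⁻¹ * f 1 = f 1 * s
      simp
    · show f 2 * f 1 * s * (f 1)⁻¹ * (f 2)⁻¹ * f 2 = f 2 * (f 1 * s * (f 1)⁻¹)
      simp [mul_assoc]

/-- Conjugating within the base group gathers the cycle product at coordinate 0; thus only its class
in H matters. -/
theorem isConj_rotate {f : Fin 3 → H} {g s : H} (h : g * (f 0 * f 2 * f 1) = s * g) :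
    IsConj (⟨f, finRotate 3⟩ : Wr H 3) ⟨Pi.mulSingle 0 s, finRotate 3⟩ := by
  refine isConj_iff.2 ⟨⟨![g, g * (f 1)⁻¹, g * (f 1)⁻¹ * (f 2)⁻¹], 1⟩, mul_inv_eq_of_eq_mul ?_⟩
  refine SemidirectProduct.ext (funext fun a => ?_) ((one_mul _).trans (mul_one _).symm)
  rw [wr_mul_left, wr_mul_left]
  fin_cases a
  · show g * f 0 = s * (g * (f 1)⁻¹ * (f 2)⁻¹)
    rw [← mul_assoc, eq_mul_inv_iff_mul_eq, ← mul_assoc, eq_mul_inv_iff_mul_eq, ← h]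
    simp [mul_assoc]
  · show g * (f 1)⁻¹ * f 1 = 1 * g
    simp
  · show g * (f 1)⁻¹ * (f 2)⁻¹ * f 2 = 1 * (g * (f 1)⁻¹)
    simp

instance : Fintype (Wr (Sym 3) 3) := SemidirectProduct.fintype _

theorem isOddClass_wr_three :
    IsOddClass ({x : Wr (Sym 3) 3 | x ^ 9 = 1 ∧ x ^ 3 ≠ 1} : Finset _) := by
  have htx : (⟨fun _ => Equiv.swap 0 1, Equiv.swap 0 2⟩ : Wr (Sym 3) 3) *
      ⟨Pi.mulSingle 0 (finRotate 3), finRotate 3⟩ * ⟨fun _ => Equiv.swap 0 1, Equiv.swap 0 2⟩ =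
      (⟨Pi.mulSingle 0 (finRotate 3), finRotate 3⟩ : Wr (Sym 3) 3)⁻¹ := by decide +kernel
  have htt : (⟨fun _ => Equiv.swap 0 1, Equiv.swap 0 2⟩ : Wr (Sym 3) 3) *
      ⟨fun _ => Equiv.swap 0 1, Equiv.swap 0 2⟩ = 1 := by decide +kernel
  have hrot : ∀ s : Sym 3, (CentralizedByInvolution s ∧ (s = 1 ∨ s ^ 3 ≠ 1)) ∨
      (s ^ 3 = 1 ∧ s ≠ 1 ∧ ∃ g, g * s = finRotate 3 * g) := by
    unfold CentralizedByInvolution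
    decide +kernel
  -- The cycle product decides: a 3-cycle gives an element of order nine in the class of x₀, and
  -- anything else commutes with an involution.
  have hdich : ∀ f : Fin 3 → Sym 3,
      (CentralizedByInvolution (⟨f, finRotate 3⟩ : Wr (Sym 3) 3) ∧
        ¬ ((⟨f, finRotate 3⟩ : Wr (Sym 3) 3) ^ 9 = 1 ∧ (⟨f, finRotate 3⟩ : Wr (Sym 3) 3) ^ 3 ≠ 1)) ∨
      (((⟨f, finRotate 3⟩ : Wr (Sym 3) 3) ^ 9 = 1 ∧ (⟨f, finRotate 3⟩ : Wr (Sym 3) 3) ^ 3 ≠ 1) ∧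
        IsConj (⟨f, finRotate 3⟩ : Wr (Sym 3) 3) ⟨Pi.mulSingle 0 (finRotate 3), finRotate 3⟩) := by
    intro f
    rcases hrot (f 0 * f 2 * f 1) with ⟨h, h'⟩ | ⟨h1, h2, g, hg⟩
    · refine Or.inl ⟨centralizedByInvolution_rotate h, fun ⟨h9, h3⟩ => ?_⟩
      rw [show 9 = 3 * 3 from rfl, pow_mul] at h9
      rw [wr_cube] at h9 h3
      rcases h' with h' | h'
      · refine h3 (SemidirectProduct.ext (funext fun a => ?_) rfl)
        fin_cases a
        · exact h'
        · show f 1 * f 0 * f 2 = 1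
          rwa [mul_assoc, mul_eq_one_comm]
        · show f 2 * f 1 * f 0 = 1
          rwa [mul_assoc, mul_eq_one_comm, mul_assoc, mul_eq_one_comm]
      · exact h' (congrFun (congrArg SemidirectProduct.left h9) 0)
    · have hc := isConj_rotate hg
      refine Or.inr ⟨⟨?_, ?_⟩, hc⟩
      · obtain ⟨c, hc⟩ := isConj_iff.1 hc.symm
        rw [← hc, conj_pow, show (⟨Pi.mulSingle 0 (finRotate 3), finRotate 3⟩ : Wr (Sym 3) 3) ^ 9 = 1
          by decide +kernel, mul_one, mul_inv_cancel]
      · rw [wr_cube]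
        exact fun h => h2 (congrFun (congrArg SemidirectProduct.left h) 0)
  have hright : ∀ σ : Sym 3, σ ^ (2 * 3) = 1 ∧
      (σ ^ 3 ≠ 1 ∨ σ = 1 ∨ σ = finRotate 3 ∨ σ⁻¹ = finRotate 3) := by decide +kernel
  have hnine : ∀ x : Wr (Sym 3) 3, ∀ m : ℕ, x ^ m = 1 → x.right ^ m = 1 := fun x m hx => by
    have := congrArg SemidirectProduct.rightHom hx
    rwa [map_pow, map_one] at this
  -- x₀ is real, so elements over the inverse rotation are treated by inverting them.
  have hinv : IsConj (⟨Pi.mulSingle 0 (finRotate 3), finRotate 3⟩ : Wr (Sym 3) 3)⁻¹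
      ⟨Pi.mulSingle 0 (finRotate 3), finRotate 3⟩ := by
    refine IsConj.symm (isConj_iff.2 ⟨⟨fun _ => Equiv.swap 0 1, Equiv.swap 0 2⟩, ?_⟩)
    rw [← htx, eq_inv_of_mul_eq_one_left htt, inv_inv, ← eq_inv_of_mul_eq_one_left htt]
  refine isOddClass_of_order_nine
    (x₀ := ⟨Pi.mulSingle 0 (finRotate 3), finRotate 3⟩)
    (t := ⟨fun _ => Equiv.swap 0 1, Equiv.swap 0 2⟩) (by decide +kernel) ?_ (by decide +kernel) ?_
    htt htx (by decide +kernel)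
  · rintro ⟨f, σ⟩ ⟨h9, h3⟩
    obtain ⟨h6, h⟩ := hright σ
    have hσ : σ ^ 3 = 1 := by
      have := hnine _ _ h9
      rwa [show 9 = 2 * 3 + 3 from rfl, pow_add, h6, one_mul] at this
    rcases h with h | rfl | rfl | h
    · exact absurd hσ h
    · change (SemidirectProduct.inl f : Wr (Sym 3) 3) ^ 9 = 1 at h9
      change (SemidirectProduct.inl f : Wr (Sym 3) 3) ^ 3 ≠ 1 at h3
      rw [← map_pow, map_eq_one_iff _ SemidirectProduct.inl_injective] at h9
      rw [← map_pow, Ne, map_eq_one_iff _ SemidirectProduct.inl_injective] at h3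
      refine absurd (funext fun i => ?_) h3
      have := congrFun h9 i
      rwa [show 9 = 2 * 3 + 3 from rfl, Pi.pow_apply, pow_add, (hright _).1, one_mul] at this
    · exact ((hdich f).resolve_left fun h => h.2 ⟨h9, h3⟩).2
    · have hx : (⟨f, σ⟩ : Wr (Sym 3) 3)⁻¹ = ⟨(⟨f, σ⟩ : Wr (Sym 3) 3)⁻¹.left, finRotate 3⟩ :=
        SemidirectProduct.ext rfl h
      have := ((hdich (⟨f, σ⟩ : Wr (Sym 3) 3)⁻¹.left).resolve_left fun h => h.2 ?_).2
      · rw [← hx] at this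
        obtain ⟨c, hc⟩ := isConj_iff.1 this
        refine IsConj.trans (isConj_iff.2 ⟨c, ?_⟩) hinv
        rw [← hc, conj_inv, inv_inv]
      · rw [← hx, inv_pow, inv_pow, inv_eq_one, Ne, inv_eq_one]
        exact ⟨h9, h3⟩
  · rintro ⟨f, σ⟩ hQ
    obtain ⟨h6, h | rfl | rfl | h⟩ := hright σ
    · exact centralizedByInvolution_of_map SemidirectProduct.rightHom (m := 3) h6 h
    · exact centralizedByInvolution_base (n := 1) f
    · exact ((hdich f).resolve_right fun h => hQ h.1).1
    · have hx : (⟨f, σ⟩ : Wr (Sym 3) 3)⁻¹ = ⟨(⟨f, σ⟩ : Wr (Sym 3) 3)⁻¹.left, finRotate 3⟩ :=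
        SemidirectProduct.ext rfl h
      refine CentralizedByInvolution.of_inv ?_
      rw [hx]
      refine ((hdich _).resolve_right fun h => hQ ?_).1
      rw [← hx, inv_pow, inv_pow, inv_eq_one, Ne, inv_eq_one] at h
      exact h.1

end Wreath

/-! ### The group (C₃ × C₃) ⋊ C₂. -/

section Inversion

/-- The complement of the `i`-th of the four subgroups of order three of `C₃ × C₃`. -/
def lineCompl (i : Fin 4) : Finset C3SqInv :=
  {x | x.right = 1 ∧ ![x.left.1, x.left.2, x.left.1 * x.left.2, x.left.1 / x.left.2] i ≠ 1}

/-- A generator of the `i`-th of the four subgroups of order three of `C₃ × C₃`. -/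
def lineGen (i : Fin 4) : C3SqInv :=
  let g : C3 := Multiplicative.ofAdd 1
  ⟨![(1, g), (g, 1), (g, g⁻¹), (g, g)] i, 1⟩

set_option synthInstance.maxSize 1000 in
set_option synthInstance.maxHeartbeats 200000 in
theorem defectZeroCount_c3SqInv (k : Type*) [Field k] [IsAlgClosed k] [CharP k 2] :
    DefectZeroCount k C3SqInv 4 := by
  have hstable : ∀ i g, ∀ x ∈ lineCompl i, g * x * g⁻¹ ∈ lineCompl i := by decide +kernel
  have hodd : ∀ i, ∀ x ∈ lineCompl i, ¬ CentralizedByInvolution x := by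
    unfold CentralizedByInvolution
    decide +kernel
  have hcases : ∀ x : C3SqInv, CentralizedByInvolution x ∨
      ∃ m, IsConj x (lineGen m) ∧ ∀ i, x ∈ lineCompl i ↔ i ≠ m := by
    simp only [isConj_iff]
    unfold CentralizedByInvolution
    decide +kernel
  have hcount : ∀ i j, ∀ x : C3SqInv, Finset.card {y ∈ lineCompl i | y⁻¹ * x ∈ lineCompl j} % 2 =
      if i = j ∧ x ∈ lineCompl i then 1 else 0 := by decide +kernel
  have hmem : ∀ i, ∃ x, x ∈ lineCompl i := by decide +kernel
  -- The sum over the complement of a line is e_χ + e_χ̄ for the characters χ, χ̄ with that kernel: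
  -- χ + χ̄ is 2 = 0 on the line, ω + ω² = 1 off it, and 1/9 = 1.
  have hmul : ∀ i j, setSum k (lineCompl i) * setSum k (lineCompl j) =
      if i = j then setSum k (lineCompl i) else 0 := fun i j => by
    ext x
    rw [coeff_setSum_mul_setSum, ← Nat.mod_add_div (Finset.card _) 2, hcount]
    push_cast
    rw [CharTwo.two_eq_zero, zero_mul, add_zero]
    by_cases hij : i = j
    · simp [hij, coeff_setSum]
    · simp [hij]
  have hf : ∀ i, setSum k (lineCompl i) ∈ projCenter k C3SqInv := fun i =>
    setSum_mem_projCenter _ (hstable i) (hodd i)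
  refine defectZeroCount_of_orthogonal (fun i => setSum k (lineCompl i)) hf (fun i h => ?_)
    (fun i => by rw [hmul, if_pos rfl]) (fun i j hij => by rw [hmul, if_neg hij]) fun z hz =>
    -- The idempotents arise from the four class sums by the matrix J − I of size 4, with J the
    -- all-ones matrix; modulo 2 it is its own inverse.
    ⟨fun i => ∑ j ∈ {j | j ≠ i}, z.coeff (lineGen j), ?_⟩
  · obtain ⟨x, hx⟩ := hmem i
    have := congrArg (fun a => a.coeff x) h
    simp [coeff_setSum, hx] at this
  · ext x
    simp only [coeff_sum, Finsupp.finsetSum_apply, coeff_smul_apply, coeff_setSum, smul_eq_mul,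
      mul_ite, mul_one, mul_zero]
    rcases hcases x with h | ⟨m, h1, h2⟩
    · rw [coeff_eq_zero_of_centralized hz h, Finset.sum_eq_zero]
      exact fun i _ => if_neg fun hi => hodd i x hi h
    · have h2k : (2 : k) = 0 := CharTwo.two_eq_zero
      rw [coeff_of_isConj (projCenter_le_center hz) h1]
      simp only [h2, Finset.sum_filter, Fin.sum_univ_four]
      fin_cases m <;> simp <;>
        linear_combination -(z.coeff (lineGen 0) + z.coeff (lineGen 1) + z.coeff (lineGen 2) +
          z.coeff (lineGen 3)) * h2k

end Inversion

/-! ### Powers of S₃. -/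

section Products

theorem defectZeroCount_sym_three_sq (k : Type*) [Field k] [IsAlgClosed k] [CharP k 2] :
    DefectZeroCount k (Sym 3 × Sym 3) 1 :=
  (isOddClass_sym_three.prod isOddClass_sym_three).defectZeroCount

theorem defectZeroCount_sym_three_cube (k : Type*) [Field k] [IsAlgClosed k] [CharP k 2] :
    DefectZeroCount k (Sym 3 × Sym 3 × Sym 3) 1 :=
  (isOddClass_sym_three.prod (isOddClass_sym_three.prod isOddClass_sym_three)).defectZeroCount

end Products

/-! ### Unitriangular matrices and transvections. -/

section Bruhat

variable {n : ℕ} {F : Type*} [Field F]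

/-- Upper triangular matrices with diagonal entries one. -/
def IsUnitriangular (A : Matrix (Fin n) (Fin n) F) : Prop :=
  (∀ i, A i i = 1) ∧ ∀ i j, j < i → A i j = 0

instance [DecidableEq F] (A : Matrix (Fin n) (Fin n) F) : Decidable (IsUnitriangular A) :=
  have (i : Fin n) : Decidable (∀ j, j < i → A i j = 0) :=
    @Nat.decidableForallFin _ _ fun _ => inferInstance
  inferInstanceAs (Decidable (_ ∧ _))

theorem IsUnitriangular.mul {A B : Matrix (Fin n) (Fin n) F} (hA : IsUnitriangular A)
    (hB : IsUnitriangular B) : IsUnitriangular (A * B) := by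
  refine ⟨fun i => ?_, fun i j hij => ?_⟩
  · rw [Matrix.mul_apply, Finset.sum_eq_single i, hA.1, hB.1, one_mul]
    · intro k _ hk
      rcases lt_or_gt_of_ne hk with h | h
      · rw [hA.2 _ _ h, zero_mul]
      · rw [hB.2 _ _ h, mul_zero]
    · simp
  · rw [Matrix.mul_apply]
    refine Finset.sum_eq_zero fun k _ => ?_
    rcases lt_or_ge k i with h | h
    · rw [hA.2 _ _ h, zero_mul]
    · rw [hB.2 _ _ (hij.trans_le h), mul_zero]

theorem IsUnitriangular.one : IsUnitriangular (1 : Matrix (Fin n) (Fin n) F) :=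
  ⟨fun _ => Matrix.one_apply_eq _, fun _ _ h => Matrix.one_apply_ne h.ne'⟩

theorem IsUnitriangular.det {A : Matrix (Fin n) (Fin n) F} (hA : IsUnitriangular A) :
    A.det = 1 := by
  rw [Matrix.det_of_isUpperTriangular (fun i j h => hA.2 i j h)]
  exact Finset.prod_eq_one fun i _ => hA.1 i

variable (n F) in
/-- The group of upper unitriangular matrices over a finite field. -/
def unitriangular [Finite F] : Subgroup (GL (Fin n) F) where
  carrier := {g | IsUnitriangular (g : Matrix (Fin n) (Fin n) F)}
  mul_mem' := IsUnitriangular.mul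
  one_mem' := IsUnitriangular.one
  inv_mem' {g} hg := by
    have hpow : ∀ m : ℕ, IsUnitriangular ((g ^ m : GL (Fin n) F) : Matrix (Fin n) (Fin n) F) := by
      intro m
      induction m with
      | zero => exact IsUnitriangular.one
      | succ m ih => rw [pow_succ]; exact ih.mul hg
    -- In a finite group inverses are powers, so closure under products is enough.
    have h : g ^ (orderOf g - 1) = g⁻¹ := eq_inv_of_mul_eq_one_left <| by
      rw [← pow_succ, Nat.sub_add_cancel (orderOf_pos g), pow_orderOf_eq_one]
    exact h ▸ hpow (orderOf g - 1)

variable (n F) in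
/-- The antidiagonal permutation matrix. -/
def revMatrix : Matrix (Fin n) (Fin n) F := Matrix.of fun i j => if j = i.rev then 1 else 0

theorem revMatrix_mul (A : Matrix (Fin n) (Fin n) F) (i j : Fin n) :
    (revMatrix n F * A) i j = A i.rev j := by
  simp [revMatrix, Matrix.mul_apply]

theorem mul_revMatrix (A : Matrix (Fin n) (Fin n) F) (i j : Fin n) :
    (A * revMatrix n F) i j = A i j.rev := by
  have h (k : Fin n) : j = k.rev ↔ k = j.rev := by rw [eq_comm, Fin.rev_eq_iff]
  simp [revMatrix, Matrix.mul_apply, h]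

theorem revMatrix_mul_self : revMatrix n F * revMatrix n F = 1 := by
  ext i j
  rw [revMatrix_mul]
  simp [revMatrix, Matrix.one_apply, eq_comm]

variable (n F) in
/-- The antidiagonal permutation matrix as an element of the general linear group. -/
def rev : GL (Fin n) F := ⟨revMatrix n F, revMatrix n F, revMatrix_mul_self, revMatrix_mul_self⟩

theorem rev_inv : (rev n F)⁻¹ = rev n F := rfl

theorem rev_mul_self : rev n F * rev n F = 1 := Units.ext revMatrix_mul_self

theorem coe_rev_conj (g : GL (Fin n) F) (i j : Fin n) :
    ((rev n F * g * rev n F : GL (Fin n) F) : Matrix (Fin n) (Fin n) F) i j = g.1 i.rev j.rev := by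
  show (revMatrix n F * g.1 * revMatrix n F) i j = _
  rw [mul_revMatrix, revMatrix_mul]

theorem eq_one_of_rev_conj_mem [Finite F] {p : GL (Fin n) F} (hp : p ∈ unitriangular n F)
    (hp' : rev n F * p * rev n F ∈ unitriangular n F) : p = 1 := by
  ext i j
  rcases lt_trichotomy i j with h | rfl | h
  · have := hp'.2 i.rev j.rev (Fin.rev_lt_rev.2 h)
    rw [coe_rev_conj, Fin.rev_rev, Fin.rev_rev] at this
    rw [this]
    exact (Matrix.one_apply_ne h.ne).symm
  · rw [hp.1]
    exact (Matrix.one_apply_eq _).symm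
  · rw [hp.2 _ _ h]
    exact (Matrix.one_apply_ne h.ne').symm

variable (n) in
/-- The group of lower unitriangular matrices. -/
def lowerUnitriangular (F : Type*) [Field F] [Finite F] : Subgroup (GL (Fin n) F) :=
  (unitriangular n F).comap (MulAut.conj (rev n F)).toMonoidHom

theorem mem_lowerUnitriangular [Finite F] {g : GL (Fin n) F} :
    g ∈ lowerUnitriangular n F ↔ rev n F * g * rev n F ∈ unitriangular n F := Iff.rfl

theorem mem_lowerUnitriangular_of [Finite F] {g : GL (Fin n) F} (h1 : ∀ i, g.1 i i = 1)
    (h2 : ∀ i j, i < j → g.1 i j = 0) : g ∈ lowerUnitriangular n F :=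
  ⟨fun i => (coe_rev_conj g i i).trans (h1 _), fun i j h =>
    (coe_rev_conj g i j).trans (h2 _ _ (Fin.rev_lt_rev.2 h))⟩

/-- The matrix `h` has an `LU`-decomposition, or it intertwines an upper with a lower
unitriangular involution. -/
def IsRegular [Finite F] (h : GL (Fin n) F) : Prop :=
  (∃ l ∈ lowerUnitriangular n F, ∃ u ∈ unitriangular n F, u ≠ 1 ∧ u * u = 1 ∧ l * h = h * u) ∨
    ∃ l ∈ lowerUnitriangular n F, ∃ u ∈ unitriangular n F, h = l * u

/-- Both alternatives depend only on the double coset LhU, so row and column operations are allowed.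
-/
theorem IsRegular.of_mul [Finite F] {l h u : GL (Fin n) F} (hl : l ∈ lowerUnitriangular n F)
    (hu : u ∈ unitriangular n F) (H : IsRegular (l * h * u)) : IsRegular h := by
  rcases H with ⟨l', hl', u', hu', h1, h2, h3⟩ | ⟨l', hl', u', hu', h1⟩
  · refine Or.inl ⟨l⁻¹ * l' * l, mul_mem (mul_mem (inv_mem hl) hl') hl, u * u' * u⁻¹,
      mul_mem (mul_mem hu hu') (inv_mem hu), ?_, ?_, ?_⟩
    · simpa using h1
    · rw [show u * u' * u⁻¹ * (u * u' * u⁻¹) = u * (u' * u') * u⁻¹ by group, h2]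
      group
    · rw [show l⁻¹ * l' * l * h = l⁻¹ * (l' * (l * h * u)) * u⁻¹ by group, h3]
      group
  · refine Or.inr ⟨l⁻¹ * l', mul_mem (inv_mem hl) hl', u' * u⁻¹, mul_mem hu' (inv_mem hu), ?_⟩
    rw [show l⁻¹ * l' * (u' * u⁻¹) = l⁻¹ * (l' * u') * u⁻¹ by group, ← h1]
    group

variable [CharP F 2]

/-- The involution `1 + v eₖᵀ`. -/
def colTransvection (k : Fin n) (v : Fin n → F) (hv : v k = 0) : GL (Fin n) F :=
  have h : (1 + Matrix.vecMulVec v (Pi.single k 1)) * (1 + Matrix.vecMulVec v (Pi.single k 1)) =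
      (1 : Matrix (Fin n) (Fin n) F) := by
    rw [mul_add, add_mul, add_mul, Matrix.vecMulVec_mul_vecMulVec]
    simp [hv, add_assoc, ← two_smul F (Matrix.vecMulVec _ _), CharTwo.two_eq_zero]
  ⟨_, _, h, h⟩

/-- The involution `1 + eₖ vᵀ`. -/
def rowTransvection (k : Fin n) (v : Fin n → F) (hv : v k = 0) : GL (Fin n) F :=
  have h : (1 + Matrix.vecMulVec (Pi.single k 1) v) * (1 + Matrix.vecMulVec (Pi.single k 1) v) =
      (1 : Matrix (Fin n) (Fin n) F) := by
    rw [mul_add, add_mul, add_mul, Matrix.vecMulVec_mul_vecMulVec]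
    simp [hv, add_assoc, ← two_smul F (Matrix.vecMulVec _ _), CharTwo.two_eq_zero]
  ⟨_, _, h, h⟩

theorem colTransvection_mul (k : Fin n) (v : Fin n → F) (hv : v k = 0)
    (A : Matrix (Fin n) (Fin n) F) (i j : Fin n) :
    ((colTransvection k v hv).1 * A) i j = A i j + v i * A k j := by
  simp [colTransvection, add_mul, Matrix.vecMulVec_mul, Matrix.vecMulVec_apply]

theorem mul_rowTransvection (k : Fin n) (v : Fin n → F) (hv : v k = 0)
    (A : Matrix (Fin n) (Fin n) F) (i j : Fin n) :
    (A * (rowTransvection k v hv).1) i j = A i j + A i k * v j := by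
  simp [rowTransvection, mul_add, Matrix.mul_vecMulVec, Matrix.vecMulVec_apply]

theorem colTransvection_mem [Finite F] {k : Fin n} {v : Fin n → F} (hv : ∀ i ≤ k, v i = 0) :
    colTransvection k v (hv k le_rfl) ∈ lowerUnitriangular n F := by
  have h := fun i j => colTransvection_mul k v (hv k le_rfl) 1 i j
  simp only [mul_one] at h
  refine mem_lowerUnitriangular_of (fun i => ?_) fun i j hij => ?_
  · rw [h]
    rcases eq_or_ne k i with rfl | hk
    · simp [hv k le_rfl]
    · simp [hk]
  · rw [h, Matrix.one_apply_ne hij.ne, zero_add]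
    rcases eq_or_ne k j with rfl | hk
    · simp [hv i hij.le]
    · simp [hk]

theorem rowTransvection_mem [Finite F] {k : Fin n} {v : Fin n → F} (hv : ∀ i ≤ k, v i = 0) :
    rowTransvection k v (hv k le_rfl) ∈ unitriangular n F := by
  have h := fun i j => mul_rowTransvection k v (hv k le_rfl) 1 i j
  simp only [one_mul] at h
  refine ⟨fun i => ?_, fun i j hij => ?_⟩
  · rw [h]
    rcases eq_or_ne i k with rfl | hk
    · simp [hv i le_rfl]
    · simp [hk]
  · rw [h, Matrix.one_apply_ne hij.ne', zero_add]
    rcases eq_or_ne i k with rfl | hk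
    · simp [hv j hij.le]
    · simp [hk]

end Bruhat

/-! ### Gaussian elimination and the big Bruhat cell. -/

section Elimination

variable {n : ℕ}

/-- One step of Gaussian elimination, for a matrix over the field with two elements that agrees
with the identity outside of the rows and columns from `m` on. -/
theorem isRegular_of_eq_one_below {d : ℕ} : ∀ {m : ℕ}, m + d = n → ∀ h : GL (Fin n) (ZMod 2),
    (∀ i j : Fin n, (i : ℕ) < m ∨ (j : ℕ) < m → h.1 i j = if i = j then 1 else 0) →
    IsRegular h := by
  induction d with
  | zero =>
    rintro m rfl h hh
    refine Or.inr ⟨1, one_mem _, 1, one_mem _, ?_⟩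
    ext i j
    rw [hh i j (Or.inl i.2), one_mul]
    exact (Matrix.one_apply).symm
  | succ d ih =>
    intro m hm h hh
    let k : Fin n := ⟨m, by omega⟩
    have hd : ∀ a : ZMod 2, a = 0 ∨ a = 1 := by decide
    have h2 : ∀ a : ZMod 2, a + a = 0 := by decide
    rcases hd (h.1 k k) with h0 | h1
    · have hcol : ∀ i ≤ k, h.1 i k = 0 := fun i hi => by
        rcases hi.lt_or_eq with hi | rfl
        · rw [hh i k (Or.inl hi), if_neg hi.ne]
        · exact h0
      have hrow : ∀ i ≤ k, h.1 k i = 0 := fun i hi => by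
        rcases hi.lt_or_eq with hi | rfl
        · rw [hh k i (Or.inr hi), if_neg hi.ne']
        · exact h0
      -- With a zero pivot, take the transvections built from column k and row k of h itself: both
      -- products have entries hᵢⱼ + hᵢₖhₖⱼ. The row is nonzero as h is invertible.
      refine Or.inl ⟨_, colTransvection_mem hcol, _, rowTransvection_mem hrow, fun hu => ?_, ?_, ?_⟩
      · have hdet : IsUnit h.1.det := (Matrix.isUnit_iff_isUnit_det _).1 h.isUnit
        refine hdet.ne_zero (Matrix.det_eq_zero_of_row_eq_zero k fun j => ?_)
        have := mul_rowTransvection k (fun j => h.1 k j) h0 1 k j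
        rw [hu] at this
        simpa using this
      · exact Units.ext (rowTransvection k (fun j => h.1 k j) h0).mul_inv
      · ext i j
        show ((_ : Matrix (Fin n) (Fin n) (ZMod 2)) * h.1) i j =
          (h.1 * (_ : Matrix (Fin n) (Fin n) (ZMod 2))) i j
        rw [colTransvection_mul, mul_rowTransvection]
    · have hcol : ∀ i ≤ k, (if i = k then 0 else h.1 i k) = 0 := fun i hi => by
        split_ifs with hik
        · rfl
        · rw [hh i k (Or.inl (show i < k from lt_of_le_of_ne hi hik)), if_neg hik]
      have hrow : ∀ i ≤ k, (if i = k then 0 else h.1 k i) = 0 := fun i hi => by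
        split_ifs with hik
        · rfl
        · rw [hh k i (Or.inr (show i < k from lt_of_le_of_ne hi hik)), if_neg (Ne.symm hik)]
      -- With pivot 1, the same transvections, with the pivot entry removed, clear row and column k.
      refine IsRegular.of_mul (colTransvection_mem hcol) (rowTransvection_mem hrow)
        (ih (m := m + 1) (by omega) _ fun i j hij => ?_)
      show ((_ : Matrix (Fin n) (Fin n) (ZMod 2)) * h.1 *
        (_ : Matrix (Fin n) (Fin n) (ZMod 2))) i j = _
      have hlt : ∀ i : Fin n, (i : ℕ) < m + 1 → (i : ℕ) < m ∨ i = k := fun i hi => by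
        rcases Nat.lt_succ_iff_lt_or_eq.1 hi with h | h
        · exact Or.inl h
        · exact Or.inr (Fin.ext h)
      rw [mul_rowTransvection, colTransvection_mul, colTransvection_mul, h1]
      by_cases hik : i = k
      · subst hik
        by_cases hjk : j = k
        · subst hjk
          simp [h1]
        · simp [hjk, h1, h2, Ne.symm hjk]
      · by_cases hjk : j = k
        · subst hjk
          simp [hik, h1, h2]
        · simp only [hik, hjk, if_false, mul_one, h2, zero_mul, add_zero]
          rcases hij with hi | hj
          · have hi := (hlt i hi).resolve_right hik
            rw [hh i j (Or.inl hi), hh i k (Or.inl hi), if_neg hik, zero_mul, add_zero]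
          · have hj := (hlt j hj).resolve_right hjk
            rw [hh i j (Or.inr hj), hh k j (Or.inr hj), if_neg (Ne.symm hjk), mul_zero, add_zero]

/-- Matrices outside of the big Bruhat cell conjugate some upper unitriangular involution to an
upper unitriangular matrix. -/
theorem exists_involution_or_mem_bigCell (g : GL (Fin n) (ZMod 2)) :
    (∃ q ∈ unitriangular n (ZMod 2), q ≠ 1 ∧ q * q = 1 ∧ g⁻¹ * q * g ∈ unitriangular n (ZMod 2)) ∨
      ∃ p ∈ unitriangular n (ZMod 2), ∃ q ∈ unitriangular n (ZMod 2),
        g = p * rev n (ZMod 2) * q := by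
  have hw := rev_mul_self (n := n) (F := ZMod 2)
  -- Conjugation by w exchanges upper and lower unitriangular matrices, so wg has an
  -- LU-decomposition exactly when g lies in PwP.
  rcases isRegular_of_eq_one_below (zero_add n) (rev n (ZMod 2) * g) (by simp) with
    ⟨l, hl, u, hu, h1, h2, h3⟩ | ⟨l, hl, u, hu, h⟩
  · have hq : rev n (ZMod 2) * l * rev n (ZMod 2) = g * u * g⁻¹ := by
      rw [eq_mul_inv_iff_mul_eq, mul_assoc, mul_assoc, h3, mul_assoc, ← mul_assoc, hw, one_mul]
    rw [mem_lowerUnitriangular, hq] at hl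
    refine Or.inl ⟨g * u * g⁻¹, hl, by simpa using h1, ?_, by simpa [mul_assoc] using hu⟩
    rw [show g * u * g⁻¹ * (g * u * g⁻¹) = g * (u * u) * g⁻¹ by group, h2]
    group
  · refine Or.inr ⟨_, mem_lowerUnitriangular.1 hl, u, hu, ?_⟩
    rw [mul_assoc _ _ (rev n (ZMod 2)), hw, mul_one, mul_assoc, ← h, ← mul_assoc, hw, one_mul]

/-- A matrix all of whose orbits on nonzero vectors have maximal length does not commute with an
involution. -/
theorem not_centralizedByInvolution_of_minimalPeriod {g : GL (Fin n) (ZMod 2)}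
    (hper : ∀ v, v ≠ 0 → Function.minimalPeriod g.1.mulVec v = 2 ^ n - 1) :
    ¬ CentralizedByInvolution g := by
  rintro ⟨t, h1, h2, h3⟩
  have h2' : t.1 * t.1 = 1 := congrArg Units.val h2
  have h3' : t.1 * g.1 = g.1 * t.1 := congrArg Units.val h3
  have hne : ∃ v, t.1.mulVec v + v ≠ 0 := by
    by_contra! hall
    refine h1 (Units.ext (Matrix.ext_of_mulVec_single fun i => ?_))
    rw [show t.1.mulVec (Pi.single i 1) = Pi.single i 1 from
      funext fun j => CharTwo.add_eq_zero.1 (congrFun (hall (Pi.single i 1)) j)]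
    exact (Matrix.one_mulVec _).symm
  obtain ⟨v, hv⟩ := hne
  set u := t.1.mulVec v + v with hu
  have htu : t.1.mulVec u = u := by
    rw [hu, Matrix.mulVec_add, Matrix.mulVec_mulVec, h2', Matrix.one_mulVec, add_comm]
  have hfix : ∀ i : ℕ, t.1.mulVec (g.1.mulVec^[i] u) = g.1.mulVec^[i] u := by
    intro i
    induction i with
    | zero => exact htu
    | succ i ih =>
      rw [Function.iterate_succ_apply', Matrix.mulVec_mulVec, h3', ← Matrix.mulVec_mulVec, ih]
  have hne0 : ∀ i : ℕ, g.1.mulVec^[i] u ≠ 0 := by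
    intro i
    induction i with
    | zero => exact hv
    | succ i ih =>
      rw [Function.iterate_succ_apply']
      intro h0
      apply ih
      have : g.inv.mulVec (g.1.mulVec (g.1.mulVec^[i] u)) = g.inv.mulVec 0 := by rw [h0]
      rwa [Matrix.mulVec_mulVec, g.inv_val, Matrix.one_mulVec, Matrix.mulVec_zero] at this
  -- Zero together with the orbit of u under g exhausts the space, and t fixes all of it; so tv = v,
  -- contradicting u ≠ 0.
  let f : Option (Fin (2 ^ n - 1)) → Fin n → ZMod 2 := fun o =>
    o.elim 0 fun i => g.1.mulVec^[i] u
  have hf : Function.Injective f := by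
    rintro (_ | i) (_ | j) hij
    · rfl
    · exact absurd hij.symm (hne0 j)
    · exact absurd hij (hne0 i)
    · refine congrArg some (Fin.ext ?_)
      refine Function.iterate_injOn_Iio_minimalPeriod (f := g.1.mulVec) (x := u) ?_ ?_ hij
      · rw [hper u hv]; exact i.2
      · rw [hper u hv]; exact j.2
  have hcard : Fintype.card (Option (Fin (2 ^ n - 1))) = Fintype.card (Fin n → ZMod 2) := by
    rw [Fintype.card_option, Fintype.card_fin, Fintype.card_fun, ZMod.card, Fintype.card_fin]
    exact Nat.sub_add_cancel Nat.one_le_two_pow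
  obtain ⟨o, ho⟩ := ((Fintype.bijective_iff_injective_and_card f).2 ⟨hf, hcard⟩).2 v
  refine hv ?_
  have : t.1.mulVec v = v := by
    rw [← ho]
    cases o with
    | none => exact Matrix.mulVec_zero _
    | some i => exact hfix i
  rw [hu, this]
  exact funext fun j => CharTwo.add_self_eq_zero _

end Elimination

/-! ### Reduction of GLₙ(2) to two finite counts. -/

section LinearGroups

variable {n m : ℕ}

/-- The coordinates e on the unitriangular group make both counts of
`defectZeroCount_one_of_doubleCoset` computable. Reversing row or column indices is multiplication
by w, and b in `hodd'` runs over inverses of the right factor in PwP. -/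
theorem defectZeroCount_linear (k : Type*) [Field k] [IsAlgClosed k] [CharP k 2]
    (e : (Fin m → ZMod 2) → Matrix (Fin n) (Fin n) (ZMod 2)) (he : Function.Injective e)
    (hrange : ∀ A, IsUnitriangular A ↔ ∃ a, e a = A)
    (hper : ∀ g : Matrix (Fin n) (Fin n) (ZMod 2), g ^ n = g + 1 → ∀ v, v ≠ 0 →
      Function.minimalPeriod g.mulVec v = 2 ^ n - 1)
    (hodd : Odd (Finset.card
      {a | (e a).submatrix Fin.rev id ^ n = (e a).submatrix Fin.rev id + 1}))
    (hodd' : Odd (Finset.card {a | ∃ b,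
      IsUnitriangular ((e a).submatrix Fin.rev Fin.rev * (e b).submatrix id Fin.rev)})) :
    DefectZeroCount k (GL (Fin n) (ZMod 2)) 1 := by
  classical
  have hdet (a) : (e a).det ≠ 0 := by
    rw [((hrange _).2 ⟨a, rfl⟩).det]
    exact one_ne_zero
  let E : (Fin m → ZMod 2) ≃ unitriangular n (ZMod 2) := Equiv.ofBijective
    (fun a => ⟨Matrix.GeneralLinearGroup.mkOfDetNeZero (e a) (hdet a), (hrange _).2 ⟨a, rfl⟩⟩)
    ⟨fun a b hab => he (congrArg (fun p : unitriangular n (ZMod 2) => p.1.1) hab), fun p => by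
      obtain ⟨a, ha⟩ := (hrange _).1 p.2
      exact ⟨a, Subtype.ext (Units.ext ha)⟩⟩
  have hsub (A : Matrix (Fin n) (Fin n) (ZMod 2)) :
      A.submatrix Fin.rev id = revMatrix n (ZMod 2) * A := Matrix.ext fun i j =>
    (revMatrix_mul A i j).symm
  have hsub' (A B : Matrix (Fin n) (Fin n) (ZMod 2)) :
      A.submatrix Fin.rev Fin.rev * B.submatrix id Fin.rev =
        revMatrix n (ZMod 2) * (A * revMatrix n (ZMod 2) * B) * revMatrix n (ZMod 2) := by
    rw [show A.submatrix Fin.rev Fin.rev = revMatrix n (ZMod 2) * A * revMatrix n (ZMod 2) from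
      Matrix.ext fun i j => by rw [mul_revMatrix, revMatrix_mul, Matrix.submatrix_apply],
      show B.submatrix id Fin.rev = B * revMatrix n (ZMod 2) from
      Matrix.ext fun i j => (mul_revMatrix B i j).symm]
    simp only [mul_assoc]
  simp only [hsub, hsub'] at hodd hodd'
  have := Fintype.ofFinite (unitriangular n (ZMod 2))
  have hE : ∀ (s : (Fin m → ZMod 2) → Prop) (r : unitriangular n (ZMod 2) → Prop)
      [DecidablePred s] [DecidablePred r], (∀ a, s a ↔ r (E a)) → Odd (Finset.card {a | s a}) →
      Odd (Finset.card {p | r p}) := by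
    intro s r _ _ hsr hs
    rwa [← Fintype.card_subtype, ← Fintype.card_congr (E.subtypeEquiv hsr), Fintype.card_subtype]
  refine defectZeroCount_one_of_doubleCoset (unitriangular n (ZMod 2)) ?_ (rev n (ZMod 2))
    exists_involution_or_mem_bigCell
    (fun p hp hp' => eq_one_of_rev_conj_mem hp hp')
    {x | x.1 ^ n = x.1 + 1} (fun g x hx => ?_) (fun x hx => ?_) ?_
    {g | ∃ p ∈ unitriangular n (ZMod 2), ∃ q ∈ unitriangular n (ZMod 2),
      g = p * rev n (ZMod 2) * q} (fun g => Iff.rfl) ?_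
  · refine IsPGroup.of_card (n := m) ?_
    rw [← Nat.card_congr E]
    simp
  · rw [Finset.mem_filter_univ] at hx ⊢
    rw [← Units.val_pow_eq_pow_val, conj_pow, Units.val_mul, Units.val_mul,
      Units.val_pow_eq_pow_val, hx, mul_add, add_mul, Units.val_mul, Units.val_mul, mul_one,
      Units.mul_inv]
  · rw [Finset.mem_filter_univ] at hx
    exact not_centralizedByInvolution_of_minimalPeriod (hper _ hx)
  · refine hE _ _ (fun a => ?_) hodd
    rw [Finset.mem_filter_univ]
    rfl
  · refine hE _ _ (fun a => ?_) hodd'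
    have hw := rev_mul_self (n := n) (F := ZMod 2)
    rw [rev_inv]
    constructor
    · rintro ⟨b, hb⟩
      refine ⟨rev n (ZMod 2) * ((E a).1 * rev n (ZMod 2) * (E b).1) * rev n (ZMod 2), hb,
        (E b).1⁻¹, inv_mem (E b).2, ?_⟩
      simp [mul_assoc, hw]
    · rintro ⟨p, hp, q, hq, hpq⟩
      obtain ⟨b, hb⟩ := E.surjective ⟨q⁻¹, inv_mem hq⟩
      refine ⟨b, ?_⟩
      show rev n (ZMod 2) * ((E a).1 * rev n (ZMod 2) * (E b).1) * rev n (ZMod 2) ∈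
        unitriangular n (ZMod 2)
      rw [hb]
      convert hp using 1
      rw [show rev n (ZMod 2) * ((E a).1 * rev n (ZMod 2) * q⁻¹) * rev n (ZMod 2) =
        rev n (ZMod 2) * (E a).1 * rev n (ZMod 2) * q⁻¹ * rev n (ZMod 2) by group, hpq]
      simp [mul_assoc, hw]

end LinearGroups

/-! ### Orbits of matrices with gⁿ = g + 1. -/

section Periods

theorem pow_seven_eq_one {R : Type*} [Ring R] (h2 : (2 : R) = 0) {g : R} (h : g ^ 3 = g + 1) :
    g ^ 7 = 1 := by
  rw [show g ^ 7 = g * (g ^ 3 * g ^ 3) by noncomm_ring, h,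
    show g * ((g + 1) * (g + 1)) = g ^ 3 + 2 * g ^ 2 + g by noncomm_ring, h, h2,
    show g + 1 + 0 * g ^ 2 + g = 2 * g + 1 by noncomm_ring, h2, zero_mul, zero_add]

theorem pow_five_eq {R : Type*} [Ring R] {g : R} (h : g ^ 4 = g + 1) : g ^ 5 = g ^ 2 + g := by
  rw [pow_succ, h, add_mul, one_mul, pow_two]

theorem pow_ten_eq {R : Type*} [Ring R] (h2 : (2 : R) = 0) {g : R} (h : g ^ 4 = g + 1) :
    g ^ 10 = g ^ 5 + 1 := by
  rw [show g ^ 10 = g ^ 5 * g ^ 5 by noncomm_ring, pow_five_eq h,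
    show (g ^ 2 + g) * (g ^ 2 + g) = g ^ 4 + 2 * g ^ 3 + g ^ 2 by noncomm_ring, h, h2]
  noncomm_ring

theorem pow_fifteen_eq_one {R : Type*} [Ring R] (h2 : (2 : R) = 0) {g : R} (h : g ^ 4 = g + 1) :
    g ^ 15 = 1 := by
  rw [show g ^ 15 = g ^ 10 * g ^ 5 by noncomm_ring, pow_ten_eq h2 h, add_mul, one_mul,
    show g ^ 5 * g ^ 5 = g ^ 10 by noncomm_ring, pow_ten_eq h2 h,
    show g ^ 5 + 1 + g ^ 5 = 2 * g ^ 5 + 1 by noncomm_ring, h2, zero_mul, zero_add]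

variable {n : ℕ} {F : Type*} [Field F]

theorem mulVec_iterate (g : Matrix (Fin n) (Fin n) F) (i : ℕ) (v : Fin n → F) :
    g.mulVec^[i] v = (g ^ i).mulVec v := by
  induction i with
  | zero => simp
  | succ i ih => rw [Function.iterate_succ_apply', ih, Matrix.mulVec_mulVec, pow_succ']

theorem minimalPeriod_mulVec_three {g : Matrix (Fin 3) (Fin 3) (ZMod 2)} (h : g ^ 3 = g + 1)
    {v : Fin 3 → ZMod 2} (hv : v ≠ 0) : Function.minimalPeriod g.mulVec v = 7 := by
  have h2 : (2 : Matrix (Fin 3) (Fin 3) (ZMod 2)) = 0 := by decide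
  have hdvd : Function.minimalPeriod g.mulVec v ∣ 7 := by
    refine Function.IsPeriodicPt.minimalPeriod_dvd ?_
    rw [Function.IsPeriodicPt, Function.IsFixedPt, mulVec_iterate, pow_seven_eq_one h2 h,
      Matrix.one_mulVec]
  refine ((Nat.dvd_prime (by norm_num)).1 hdvd).resolve_left fun h1 => hv ?_
  have hfix : g.mulVec v = v := Function.minimalPeriod_eq_one_iff_isFixedPt.1 h1
  have h3 : g.mulVec^[3] v = v := (Function.IsFixedPt.iterate hfix 3).eq
  rwa [mulVec_iterate, h, Matrix.add_mulVec, Matrix.one_mulVec, hfix, add_eq_left] at h3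

/-- The period divides 15. Were it to divide 3, then gv = g⁴v = gv + v; were it to divide 5, then v
= g¹⁰v = g⁵v + v = v + v. Either way v = 0. -/
theorem minimalPeriod_mulVec_four {g : Matrix (Fin 4) (Fin 4) (ZMod 2)} (h : g ^ 4 = g + 1)
    {v : Fin 4 → ZMod 2} (hv : v ≠ 0) : Function.minimalPeriod g.mulVec v = 15 := by
  have h2 : (2 : Matrix (Fin 4) (Fin 4) (ZMod 2)) = 0 := by decide
  have hdvd : Function.minimalPeriod g.mulVec v ∣ 15 := by
    refine Function.IsPeriodicPt.minimalPeriod_dvd ?_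
    rw [Function.IsPeriodicPt, Function.IsFixedPt, mulVec_iterate, pow_fifteen_eq_one h2 h,
      Matrix.one_mulVec]
  have hper : ∀ m, Function.minimalPeriod g.mulVec v ∣ m → (g ^ m).mulVec v = v := fun m hm => by
    rw [← mulVec_iterate]
    exact Function.isPeriodicPt_iff_minimalPeriod_dvd.2 hm
  have h3 : ¬ Function.minimalPeriod g.mulVec v ∣ 3 := fun hd => hv <| by
    have := congrArg g.mulVec (hper 3 hd)
    rwa [Matrix.mulVec_mulVec, ← pow_succ', h, Matrix.add_mulVec, Matrix.one_mulVec,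
      add_eq_left] at this
  have h5 : ¬ Function.minimalPeriod g.mulVec v ∣ 5 := fun hd => hv <| by
    have := hper 10 (hd.trans (by norm_num))
    rwa [pow_ten_eq h2 h, Matrix.add_mulVec, Matrix.one_mulVec, hper 5 hd, add_eq_left] at this
  have : Function.minimalPeriod g.mulVec v ≤ 15 := Nat.le_of_dvd (by norm_num) hdvd
  interval_cases Function.minimalPeriod g.mulVec v <;> simp_all

end Periods

/-! ### The groups GL₃(2) and GL₄(2). -/

section LinearGroups

theorem defectZeroCount_linear_three (k : Type*) [Field k] [IsAlgClosed k] [CharP k 2] :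
    DefectZeroCount k (GL (Fin 3) (ZMod 2)) 1 := by
  refine defectZeroCount_linear k (m := 3) (fun a => !![1, a 0, a 1; 0, 1, a 2; 0, 0, 1])
    (fun a b hab => ?_) (fun A => ⟨fun hA => ⟨![A 0 1, A 0 2, A 1 2], ?_⟩, ?_⟩)
    (fun g hg v hv => minimalPeriod_mulVec_three hg hv) (by decide +kernel) (by decide +kernel)
  · ext1 i
    fin_cases i
    · exact congrFun₂ hab 0 1
    · exact congrFun₂ hab 0 2
    · exact congrFun₂ hab 1 2
  · ext i j
    fin_cases i <;> fin_cases j <;>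
      first | rfl | exact (hA.1 _).symm | exact (hA.2 _ _ (by decide)).symm
  · rintro ⟨a, rfl⟩
    revert a
    decide +kernel

theorem defectZeroCount_linear_four (k : Type*) [Field k] [IsAlgClosed k] [CharP k 2] :
    DefectZeroCount k (GL (Fin 4) (ZMod 2)) 1 := by
  refine defectZeroCount_linear k (m := 6)
    (fun a => !![1, a 0, a 1, a 2; 0, 1, a 3, a 4; 0, 0, 1, a 5; 0, 0, 0, 1])
    (fun a b hab => ?_)
    (fun A => ⟨fun hA => ⟨![A 0 1, A 0 2, A 0 3, A 1 2, A 1 3, A 2 3], ?_⟩, ?_⟩)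
    (fun g hg v hv => minimalPeriod_mulVec_four hg hv) (by decide +kernel) ?_
  · ext1 i
    fin_cases i
    · exact congrFun₂ hab 0 1
    · exact congrFun₂ hab 0 2
    · exact congrFun₂ hab 0 3
    · exact congrFun₂ hab 1 2
    · exact congrFun₂ hab 1 3
    · exact congrFun₂ hab 2 3
  · ext i j
    fin_cases i <;> fin_cases j <;>
      first | rfl | exact (hA.1 _).symm | exact (hA.2 _ _ (by decide)).symm
  · rintro ⟨a, rfl⟩
    revert a
    decide +kernel
  · decide +kernel

end LinearGroups

end DefectZero

theorem proposition4p1 (k : Type*) [Field k] [IsAlgClosed k] [CharP k 2] :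
    DefectZero.DefectZeroCount k (DefectZero.Sym 3) 1 ∧
    DefectZero.DefectZeroCount k (DefectZero.Sym 3 × DefectZero.Sym 3) 1 ∧
    DefectZero.DefectZeroCount k (DefectZero.Sym 3 × DefectZero.Sym 3 × DefectZero.Sym 3) 1 ∧
    DefectZero.DefectZeroCount k (DefectZero.Wr (DefectZero.Sym 3) 2) 0 ∧
    DefectZero.DefectZeroCount k DefectZero.C3SqInv 4 ∧
    DefectZero.DefectZeroCount k DefectZero.C3CubeInvPerm 1 ∧
    DefectZero.DefectZeroCount k (GL (Fin 3) (ZMod 2)) 1 ∧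
    DefectZero.DefectZeroCount k (GL (Fin 4) (ZMod 2)) 1 ∧
    DefectZero.DefectZeroCount k (DefectZero.Sym 6) 1 ∧
    DefectZero.DefectZeroCount k (DefectZero.Wr (DefectZero.Sym 3) 3) 1 ∧
    DefectZero.DefectZeroCount k (DefectZero.Sym 5) 0 ∧
    DefectZero.DefectZeroCount k (alternatingGroup (Fin 7)) 0 ∧
    DefectZero.DefectZeroCount k (DefectZero.Sym 7) 0 :=
  ⟨DefectZero.defectZeroCount_sym_three k, DefectZero.defectZeroCount_sym_three_sq k,
    DefectZero.defectZeroCount_sym_three_cube k, DefectZero.defectZeroCount_wr_two k,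
    DefectZero.defectZeroCount_c3SqInv k, DefectZero.isOddClass_C3CubeInvPerm.defectZeroCount,
    DefectZero.defectZeroCount_linear_three k, DefectZero.defectZeroCount_linear_four k,
    DefectZero.defectZeroCount_sym_six k, DefectZero.isOddClass_wr_three.defectZeroCount,
    DefectZero.defectZeroCount_sym_five k, DefectZero.defectZeroCount_alternating_seven k,
    DefectZero.defectZeroCount_sym_seven k⟩
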